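/- **Asymmetric circular orbits $\mathcal N_2^\pm$.** Units are such that the mass of the body and the mass of the Schwarzschild black hole equal $1$; $b(r)=1-\frac2r$. A spinning test body (pole-dipole approximation, Tulczyjew condition $S^{\alpha\beta}p_\beta=0$) of energy $\mathcal E$ and spin length $c>0$ is described, after reduction by the rotational symmetry, by variables $\vec E,\vec Z\in\mathbb R^3$, $r$, $P_r$ with $r>2$, $Z_2>0$, $E_1^2<Z_2^2$. Put $$\rho=\sqrt{Z_2^2-E_1^2},\quad \Theta=\frac{Z_1}{Z_2}\rho,\quad \Gamma=\sqrt{b(r)}\,\rho-E_2,\quad m^2=-b(r)P_r^2+\frac{(\Theta-\mathcal E r^2)^2}{r^3(r-2)}-\frac{E_3^2+\Gamma^2}{r^2},$$ $$V=m^2r^3-2Z_1^2-Z_2^2+Z_3^2+3E_1^2\Big(1+\frac{Z_1^2}{Z_2^2}\Big),$$ $$\begin{aligned}H={}&b(r)\Big[\tfrac12+\tfrac{2\Theta^2+\rho^2}{V}\Big]P_r^2+\tfrac{\Gamma+E_2}{rV}\Big[E_1E_3\big(\tfrac{Z_1^2}{Z_2^2}-1\big)-Z_3E_2\tfrac{Z_1}{Z_2}\Big]P_r+\tfrac{\rho^2}{r^3V}\big[r\Gamma^2+Z_1^2\big]\\&-\tfrac{(\Theta-r^2\mathcal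 E)^2}{r^3(r-2)}\Big[\tfrac12-\tfrac{Z_1^2+Z_3^2-3\Theta^2}{V}\Big]+\tfrac{\rho}{rV}\big[Z_3(\Theta-2r\mathcal E)P_r-Z_1Z_2\mathcal E\big]+\tfrac{E_3^2+\Gamma^2}{r^2}\Big[\tfrac12-\tfrac{2E_1^2}{V}\Big]\\&-\tfrac{\Theta-r^2\mathcal E}{r^2V\sqrt{r(r-2)}}\big[E_1E_3Z_3+Z_1Z_2E_2\big]-\tfrac1{r^2V}\Big[\tfrac{Z_1}{Z_2}E_1E_3+Z_3\Gamma\Big]^2.\end{aligned}$$ The reduced system (where $V\ne0$) is, with ${\bf J}={\rm diag}(1,-1,1)$, $$\dot{\vec E}=\frac{\partial H}{\partial\vec E}\times\vec E,\quad \dot{\vec Z}=\frac{\partial H}{\partial\vec Z}\times({\bf J}\vec Z),\quad \dot r=\frac{\partial H}{\partial P_r},\quad \dot P_r=-\frac{\partial H}{\partial r}.$$ A *relative equilibrium* is a fixed point of it that satisfies $-Z_1^2+Z_2^2-Z_3^2=c^2$, $m^2=1$, the two Tulczyjew relations $$-\Theta P_r-\frac{\rho Z_3}{r}+\frac{E_2Z_2Z_3-E_1Z_1E_3}{Z_2\sqrt{r(r-2)}}=0,\qquad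 -\mathcal E\Theta+\frac{\Theta^2}{r^2}-\frac{(\Gamma+E_2)\Gamma}{r}=0,$$ and $U<0$ (time-like velocity), where $U=\frac1{b(r)}\big(\frac{\partial H}{\partial P_r}\big)^2+r^2\big(\frac{\partial H}{\partial E_2}\big)^2+r^2\big(\frac{\partial H}{\partial E_3}\big)^2-b(r)\big(\frac{\partial H}{\partial\mathcal E}\big)^2$. For real $\mathcal E$, $r>2$, $z>c$ let $$W=\frac{r^2z}{c\sqrt{z^2-c^2}}\big(c\,\mathcal E-z\sqrt{b(r)}\big),\qquad E_2^{(2)}=W\Big(\sqrt{b(r)}-\frac{z^2-c^2}{rz^2\sqrt{b(r)}}\Big)+\frac{r\,\mathcal E\sqrt{z^2-c^2}}{z\sqrt{b(r)}},$$ and, when $W^2<z^2$, let $\mathcal N_2^\pm$ be the point $$\vec E=\big(\pm\sqrt{z^2-W^2},\,E_2^{(2)},\,0\big),\quad \vec Z=\big(\sqrt{z^2-c^2},\,z,\,0\big),\quad r,\quad P_r=0,$$ so that $E_3=0$ and $E_1\neq0$. Consider the system $$6r^{7/2}c^3\mathcal E-\sqrt{3\zeta(z^2-c^2)}-3z\sqrt{r-2}\,\big(2c^2r^3-(2r^3+c^2)(z^2-c^2)\big)=0,\tag{1}$$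 $$\begin{aligned}&\tfrac{z\sqrt{3\zeta}}2\Big[z^2(r-2)\big(c^4-(2r^3+c^2)z^2\big)+c^2r^3\big((r-3)z^2+c^2(r-\tfrac53)\big)\Big]\\&+\sqrt{(r-2)(z^2-c^2)}\Big(\tfrac{z^2\zeta}2+\tfrac{c^2r^3z^2}2(2r^3+c^2)\big(3(z^2-c^2)(r-1)-2c^2\big)+c^4r^6(c^2+3z^2)\Big)=0,\end{aligned}\tag{2}$$ where $\zeta=3z^2(r-2)(2r^3+c^2)^2(z^2-c^2)+4c^4r^3(r^3+2c^2)>0$. 1. For all $\mathcal E$, $r>2$, $z>c$ with $W^2<z^2$, the points $\mathcal N_2^\pm$ are relative equilibria if and only if $(r,z,\mathcal E)$ satisfies (1), (2). 2. For every $c>0$ there are $\mathcal E$, $r>2$, $z>c$ with $W^2<z^2$ that satisfy (1), (2). 3. At the points $\mathcal N_2^\pm$ with (1), (2): consider the states of the body over such a point, in spherical coordinates in which the components $Q_1,Q_2$ of the total angular momentum vanish. Such states exist, and for each of them $P_\theta=0$, $P_\varphi\ne0$, $\cos\theta=E_1/P_\varphi$, so $\theta\neq\frac\pi2$. The spin (Pauli-Lubanski)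 vector $S^\alpha=\frac{\varepsilon^{\alpha\beta\mu\nu}}{2\sqrt{-g}}p_\beta S_{\mu\nu}$ satisfies $S^r\neq0$, $S^\theta\neq0$, $S^\varphi=0$, and its spatial part is not parallel to the (nonzero) orbital angular momentum $\vec r\times\vec p$ (the two are linearly independent). -/

import Mathlib

noncomputable section

namespace SpinningBody

/-! Motion of a spinning test body (pole-dipole approximation, Tulczyjew condition) around a
Schwarzschild black hole, in units in which both masses equal one: `m = 1`, `μ = 1`.
Components `1, 2, 3` of a vector of the reduced system are its entries `0, 1, 2`. -/

/-- The metric function `a(r) = b(r) = 1 - 2 / r`. -/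
def lapse (r : ℝ) : ℝ := 1 - 2 / r

/-! ### The reduced Hamiltonian system -/

/-- The reduced variables `(E, Z, r, P_r)`. -/
structure ReducedState where
  E : Fin 3 → ℝ
  Z : Fin 3 → ℝ
  r : ℝ
  Pr : ℝ

/-- `√(Z₂² - E₁²)` -/
def rho (x : ReducedState) : ℝ := √(x.Z 1 ^ 2 - x.E 0 ^ 2)

/-- `Θ = (Z₁ / Z₂) √(Z₂² - E₁²)` -/
def Theta (x : ReducedState) : ℝ := x.Z 0 / x.Z 1 * rho x

/-- `Γ = √(a(r) (Z₂² - E₁²)) - E₂` -/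
def Gam (x : ReducedState) : ℝ := √(lapse x.r * (x.Z 1 ^ 2 - x.E 0 ^ 2)) - x.E 1

/-- The squared mass `- p_α p^α` of the body as a function of the reduced variables and of the
energy `en`. -/
def massSq (en : ℝ) (x : ReducedState) : ℝ :=
  -lapse x.r * x.Pr ^ 2 + (Theta x - en * x.r ^ 2) ^ 2 / (x.r ^ 3 * (x.r - 2))
    - (x.E 2 ^ 2 + Gam x ^ 2) / x.r ^ 2

/-- The function `V`, with the squared mass replaced by its expression in the reduced variables. -/
def V (en : ℝ) (x : ReducedState) : ℝ :=
  massSq en x * x.r ^ 3 - 2 * x.Z 0 ^ 2 - x.Z 1 ^ 2 + x.Z 2 ^ 2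
    + 3 * x.E 0 ^ 2 * (1 + x.Z 0 ^ 2 / x.Z 1 ^ 2)

/-- The reduced Hamiltonian. -/
def H (en : ℝ) (x : ReducedState) : ℝ :=
  lapse x.r * (1 / 2 + (2 * Theta x ^ 2 + x.Z 1 ^ 2 - x.E 0 ^ 2) / V en x) * x.Pr ^ 2
  + (Gam x + x.E 1) / (x.r * V en x)
      * (x.E 0 * x.E 2 * (x.Z 0 ^ 2 / x.Z 1 ^ 2 - 1) - x.Z 2 * x.E 1 * (x.Z 0 / x.Z 1)) * x.Pr
  + (x.Z 1 ^ 2 - x.E 0 ^ 2) / (x.r ^ 3 * V en x) * (x.r * Gam x ^ 2 + x.Z 0 ^ 2)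
  - (Theta x - x.r ^ 2 * en) ^ 2 / (x.r ^ 3 * (x.r - 2))
      * (1 / 2 - (x.Z 0 ^ 2 + x.Z 2 ^ 2 - 3 * Theta x ^ 2) / V en x)
  + rho x / (x.r * V en x)
      * (x.Z 2 * (Theta x - 2 * x.r * en) * x.Pr - x.Z 0 * x.Z 1 * en)
  + (x.E 2 ^ 2 + Gam x ^ 2) / x.r ^ 2 * (1 / 2 - 2 * x.E 0 ^ 2 / V en x)
  - (Theta x - x.r ^ 2 * en) / (x.r ^ 2 * V en x * √(x.r * (x.r - 2)))
      * (x.E 0 * x.E 2 * x.Z 2 + x.Z 0 * x.Z 1 * x.E 1)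
  - 1 / (x.r ^ 2 * V en x) * (x.Z 0 / x.Z 1 * x.E 0 * x.E 2 + x.Z 2 * Gam x) ^ 2

/-- `∂H/∂E` -/
def gradE (en : ℝ) (x : ReducedState) : Fin 3 → ℝ := fun i =>
  deriv (fun s => H en { x with E := Function.update x.E i s }) (x.E i)

/-- `∂H/∂Z` -/
def gradZ (en : ℝ) (x : ReducedState) : Fin 3 → ℝ := fun i =>
  deriv (fun s => H en { x with Z := Function.update x.Z i s }) (x.Z i)

/-- `∂H/∂r` -/
def dHdr (en : ℝ) (x : ReducedState) : ℝ := deriv (fun s => H en { x with r := s }) x.r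

/-- `∂H/∂P_r` -/
def dHdPr (en : ℝ) (x : ReducedState) : ℝ := deriv (fun s => H en { x with Pr := s }) x.Pr

/-- The derivative of `H` with respect to the energy. -/
def dHden (en : ℝ) (x : ReducedState) : ℝ := deriv (fun s => H s x) en

/-- `J = diag(1, -1, 1)` applied to `Z`. -/
def JZ (Z : Fin 3 → ℝ) : Fin 3 → ℝ := ![Z 0, -Z 1, Z 2]

/-- The vector field of the reduced system: the Hamiltonian vector field of `H` for the bracket
`{E₁,E₂} = E₃`, `{E₁,E₃} = -E₂`, `{E₂,E₃} = E₁`, `{Z₁,Z₂} = Z₃`, `{Z₁,Z₃} = Z₂`, `{Z₂,Z₃} = Z₁`,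
`{r,P_r} = 1`, where the derivative of a function `f` along the flow is `{f, H}`. -/
def vectorField (en : ℝ) (x : ReducedState) : ReducedState where
  E := crossProduct (gradE en x) x.E
  Z := crossProduct (gradZ en x) (JZ x.Z)
  r := dHdPr en x
  Pr := -dHdr en x

/-- The domain in which the reduced system is nonsingular, outside the event horizon. -/
def IsRegular (en : ℝ) (x : ReducedState) : Prop :=
  2 < x.r ∧ 0 < x.Z 1 ∧ x.E 0 ^ 2 < x.Z 1 ^ 2 ∧ V en x ≠ 0

/-- A fixed point of the reduced system. -/
def IsEquilibrium (en : ℝ) (x : ReducedState) : Prop :=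
  IsRegular en x ∧ (vectorField en x).E = 0 ∧ (vectorField en x).Z = 0 ∧
    (vectorField en x).r = 0 ∧ (vectorField en x).Pr = 0

/-- The Casimir function `C_∘`, the square of the spin length. -/
def casimirZ (x : ReducedState) : ℝ := -x.Z 0 ^ 2 + x.Z 1 ^ 2 - x.Z 2 ^ 2

/-- The invariant manifold of the reduced system that is given by the Tulczyjew condition
`S^{αβ} p_β = 0`. -/
def OnTulczyjew (en : ℝ) (x : ReducedState) : Prop :=
  -Theta x * x.Pr - rho x * x.Z 2 / x.r
      + (x.E 1 * x.Z 1 * x.Z 2 - x.E 0 * x.Z 0 * x.E 2) / (x.Z 1 * √(x.r * (x.r - 2))) = 0 ∧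
  -en * Theta x + Theta x ^ 2 / x.r ^ 2 - (Gam x + x.E 1) * Gam x / x.r = 0

/-- The square `U` of the velocity of the body, which has to be negative. -/
def U (en : ℝ) (x : ReducedState) : ℝ :=
  1 / lapse x.r * dHdPr en x ^ 2 + x.r ^ 2 * gradE en x 1 ^ 2 + x.r ^ 2 * gradE en x 2 ^ 2
    - lapse x.r * dHden en x ^ 2

/-- Relative equilibria (circular orbits) of a body of unit mass, spin length `c` and energy `en`:
fixed points of the reduced system on the invariant manifold of the Tulczyjew condition, at which
the velocity is time-like. -/
def IsRelativeEquilibrium (c en : ℝ) (x : ReducedState) : Prop :=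
  casimirZ x = c ^ 2 ∧ massSq en x = 1 ∧ OnTulczyjew en x ∧ IsEquilibrium en x ∧ U en x < 0

/-! ### The asymmetric family -/

/-- The function `W` of the parameters. -/
def orbitW (c en r z : ℝ) : ℝ :=
  r ^ 2 * z / (c * √(z ^ 2 - c ^ 2)) * (c * en - z * √(lapse r))

/-- The component `E₂` of the asymmetric family. -/
def orbitE2 (c en r z : ℝ) : ℝ :=
  orbitW c en r z * (√(lapse r) - (z ^ 2 - c ^ 2) / (r * z ^ 2 * √(lapse r)))
    + r * en * √(z ^ 2 - c ^ 2) / (z * √(lapse r))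

/-- The points `N₂^±`, where the sign is `sgn = 1` or `sgn = -1`. -/
def N2 (sgn c en r z : ℝ) : ReducedState where
  E := ![sgn * √(z ^ 2 - orbitW c en r z ^ 2), orbitE2 c en r z, 0]
  Z := ![√(z ^ 2 - c ^ 2), z, 0]
  r := r
  Pr := 0

/-- The function `ζ` of the parameters. -/
def zeta (c r z : ℝ) : ℝ :=
  3 * z ^ 2 * (r - 2) * (2 * r ^ 3 + c ^ 2) ^ 2 * (z ^ 2 - c ^ 2)
    + 4 * c ^ 4 * r ^ 3 * (r ^ 3 + 2 * c ^ 2)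

/-- The algebraic system that the parameters of the asymmetric family satisfy. -/
def ParameterSystem (c en r z : ℝ) : Prop :=
  0 < zeta c r z ∧
  6 * r ^ (7 / 2 : ℝ) * c ^ 3 * en - √(3 * zeta c r z * (z ^ 2 - c ^ 2))
      - 3 * z * √(r - 2) * (2 * c ^ 2 * r ^ 3 - (2 * r ^ 3 + c ^ 2) * (z ^ 2 - c ^ 2)) = 0 ∧
  z * √(3 * zeta c r z) / 2 *
      (z ^ 2 * (r - 2) * (c ^ 4 - (2 * r ^ 3 + c ^ 2) * z ^ 2)
        + c ^ 2 * r ^ 3 * ((r - 3) * z ^ 2 + c ^ 2 * (r - 5 / 3)))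
    + √((r - 2) * (z ^ 2 - c ^ 2)) *
      (z ^ 2 * zeta c r z / 2
        + c ^ 2 * r ^ 3 * z ^ 2 / 2 * (2 * r ^ 3 + c ^ 2)
            * (3 * (z ^ 2 - c ^ 2) * (r - 1) - 2 * c ^ 2)
        + c ^ 4 * r ^ 6 * (c ^ 2 + 3 * z ^ 2)) = 0

/-- The range of the parameters in which the points `N₂^±` are real, lie outside the horizon and
have `E₁ ≠ 0`. -/
def ParameterRange (c en r z : ℝ) : Prop :=
  2 < r ∧ c < z ∧ orbitW c en r z ^ 2 < z ^ 2

/-! ### The states of the body and its spin vector -/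

/-- A state of the body: `L` and `M` are the parts of the spin tensor in the orthonormal tetrad
`e₀ = a^{-1/2} ∂_t`, `e₁ = a^{1/2} ∂_r`, `e₂ = r⁻¹ ∂_θ`, `e₃ = (r sin θ)⁻¹ ∂_φ`, and `Pr`, `Pth`,
`Pph` are the canonical momenta. The time is cyclic and is omitted; its canonical momentum is
`P_t = - en`, where `en` is the energy. -/
structure BodyState where
  L : Fin 3 → ℝ
  M : Fin 3 → ℝ
  r : ℝ
  th : ℝ
  ph : ℝ
  Pr : ℝ
  Pth : ℝ
  Pph : ℝ

/-- The reduced variables of a state. -/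
def BodyState.reduce (s : BodyState) : ReducedState where
  E := ![s.L 0,
    s.L 2 * s.Pth / √(s.L 1 ^ 2 + s.L 2 ^ 2)
      + s.L 1 * (s.L 0 * Real.cos s.th - s.Pph) / (Real.sin s.th * √(s.L 1 ^ 2 + s.L 2 ^ 2)),
    -(s.L 1 * s.Pth / √(s.L 1 ^ 2 + s.L 2 ^ 2))
      + s.L 2 * (s.L 0 * Real.cos s.th - s.Pph) / (Real.sin s.th * √(s.L 1 ^ 2 + s.L 2 ^ 2))]
  Z := ![-(s.M 0 * √(s.L 0 ^ 2 + s.L 1 ^ 2 + s.L 2 ^ 2) / √(s.L 1 ^ 2 + s.L 2 ^ 2)),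
    √(s.L 0 ^ 2 + s.L 1 ^ 2 + s.L 2 ^ 2),
    (s.M 1 * s.L 2 - s.M 2 * s.L 1) / √(s.L 1 ^ 2 + s.L 2 ^ 2)]
  r := s.r
  Pr := s.Pr

/-- The component `Q₁` of the angular momentum integral. -/
def BodyState.Q1 (s : BodyState) : ℝ :=
  Real.cos s.ph / Real.sin s.th * (s.L 0 - s.Pph * Real.cos s.th) - s.Pth * Real.sin s.ph

/-- The component `Q₂` of the angular momentum integral. -/
def BodyState.Q2 (s : BodyState) : ℝ :=
  Real.sin s.ph / Real.sin s.th * (s.L 0 - s.Pph * Real.cos s.th) + s.Pth * Real.cos s.ph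

/-- `s` is a state over the point `x` of the reduced system, in spherical coordinates that are
adapted to the integral `Q`, that is, in which `Q₁ = Q₂ = 0`. -/
def BodyState.IsOver (s : BodyState) (x : ReducedState) : Prop :=
  0 < s.th ∧ s.th < Real.pi ∧ s.L 0 * s.M 0 + s.L 1 * s.M 1 + s.L 2 * s.M 2 = 0 ∧
    s.reduce = x ∧ s.Q1 = 0 ∧ s.Q2 = 0

/-- The spin tensor `S^{AB}` in the orthonormal tetrad. -/
def BodyState.spinTetrad (s : BodyState) : Matrix (Fin 4) (Fin 4) ℝ :=
  !![0, s.M 0, s.M 1, s.M 2;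
    -s.M 0, 0, s.L 2, -s.L 1;
    -s.M 1, -s.L 2, 0, s.L 0;
    -s.M 2, s.L 1, -s.L 0, 0]

/-- The coefficients of the tetrad: `e_A = (scale A) ∂_A`, with the coordinates `(t, r, θ, φ)`. -/
def BodyState.scale (s : BodyState) : Fin 4 → ℝ :=
  ![1 / √(lapse s.r), √(lapse s.r), 1 / s.r, 1 / (s.r * Real.sin s.th)]

/-- The diagonal of the Schwarzschild metric. -/
def BodyState.metric (s : BodyState) : Fin 4 → ℝ :=
  ![-lapse s.r, 1 / lapse s.r, s.r ^ 2, s.r ^ 2 * Real.sin s.th ^ 2]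

/-- The spin tensor `S_{μν}` with lower coordinate indices. -/
def BodyState.spinLower (s : BodyState) (i j : Fin 4) : ℝ :=
  s.metric i * s.metric j * (s.spinTetrad i j * s.scale i * s.scale j)

/-- The linear momentum `p_α = P_α + ω_{αAB} S^{AB} / 2` in the coordinate basis. -/
def BodyState.momentum (en : ℝ) (s : BodyState) : Fin 4 → ℝ :=
  ![-en - s.spinTetrad 0 1 / s.r ^ 2,
    s.Pr,
    s.Pth - √(lapse s.r) * s.spinTetrad 1 2,
    s.Pph - √(lapse s.r) * Real.sin s.th * s.spinTetrad 1 3 - Real.cos s.th * s.spinTetrad 2 3]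

/-- The Levi-Civita symbol, equal to one at `(0, 1, 2, 3)`, as a Vandermonde product. -/
def leviCivita (i j k l : Fin 4) : ℝ :=
  ((j : ℝ) - (i : ℝ)) * ((k : ℝ) - (i : ℝ)) * ((l : ℝ) - (i : ℝ)) *
    ((k : ℝ) - (j : ℝ)) * ((l : ℝ) - (j : ℝ)) * ((l : ℝ) - (k : ℝ)) / 12

/-- The Pauli-Lubanski vector `S^α = ε^{αβμν} p_β S_{μν} / (2 m √(-g))`, with `m = 1` and
`√(-g) = r² sin θ`, in the coordinate basis `(t, r, θ, φ)`. -/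
def BodyState.spinVector (en : ℝ) (s : BodyState) (i : Fin 4) : ℝ :=
  (∑ j, ∑ k, ∑ l, leviCivita i j k l * s.momentum en j * s.spinLower k l)
    / (2 * (s.r ^ 2 * Real.sin s.th))

/-- The spatial part of the spin vector in the orthonormal triad `e₁, e₂, e₃`. -/
def BodyState.spinTriad (en : ℝ) (s : BodyState) : Fin 3 → ℝ :=
  ![s.spinVector en 1 / √(lapse s.r), s.r * s.spinVector en 2,
    s.r * Real.sin s.th * s.spinVector en 3]

/-- The orbital angular momentum, the cross product of the position vector `r e₁` and of the
spatial part of the linear momentum, in the orthonormal triad `e₁, e₂, e₃`. -/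
def BodyState.orbitalTriad (en : ℝ) (s : BodyState) : Fin 3 → ℝ :=
  crossProduct ![s.r, 0, 0]
    ![√(lapse s.r) * s.momentum en 1, s.momentum en 2 / s.r,
      s.momentum en 3 / (s.r * Real.sin s.th)]

end SpinningBody

end

open SpinningBody

open SpinningBody

namespace SpinningBody

open Topology Filter

/-! Write y = Z₁, z = Z₂, w = √(Z₂² - E₁²), b = √(1 - 2/r). Where E₃ = Z₃ = P_r = 0, the Hamiltonian
is -(f² - g²)/2 + K/V, with f, g the time and azimuthal components of the momentum in the tetrad and
K divisible by y f - z g (`H_planar`). At points with (f, g) = (-z/k, -y/k) that factor vanishes, so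
the derivatives of V drop out and every gradient is an explicit rational expression
(`hasDerivAt_H_planar`). For k² = z² - y² these points have unit mass; the points of the family with
W > 0 are of this kind with k = c.

The fixed-point equations then collapse to two polynomial equations for w: a cubic from the motion
of E and, modulo it, a quadratic from the motion of P_r. The motion of Z adds nothing
(`isEquilibrium_iff`). The cubic modulo the quadratic is linear in w (`orbitCubic_eq_zero_iff`).
Completing the square in the quadratic and taking its positive root gives the first equation of
`ParameterSystem`; inserting this root in the linear equation gives the second
(`parameterSystem_iff`).

The side conditions V ≠ 0 and U < 0 both follow from r(z - y) < 3bcw (`orbit_sub_lt`). A relative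
equilibrium with W < 0 would be of the same kind with k = -c, where the quadratic has no admissible
solution. For existence, w = z/2 is prescribed, the cubic is solved for y/z, and the quadratic is
solved in r by the intermediate value theorem. For the spin, p_φ is the only nonzero spatial
momentum component, so the orbital angular momentum points along e₂, while S^r is a nonzero multiple
of E₁. -/

/-! ### The Hamiltonian in the planar sector E₃ = Z₃ = P_r = 0. -/

/-- The normalized time component of the linear momentum, as a function of the reduced variables. -/
noncomputable def timeMomentum (en : ℝ) (x : ReducedState) : ℝ :=
  (Theta x - en * x.r ^ 2) / (x.r ^ 2 * √(lapse x.r))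

/-- The normalized azimuthal component of the linear momentum. -/
noncomputable def azimuthalMomentum (x : ReducedState) : ℝ :=
  (√(lapse x.r) * rho x - x.E 1) / x.r

theorem lapse_pos {r : ℝ} (hr : 2 < r) : 0 < lapse r := by
  have : 2 / r < 1 := by rw [div_lt_one (by linarith)]; exact hr
  unfold lapse; linarith

theorem mul_lapse {r : ℝ} (hr : r ≠ 0) : r * lapse r = r - 2 := by
  unfold lapse; field_simp

theorem sqrt_lapse_sq {r : ℝ} (hr : 2 < r) : √(lapse r) ^ 2 = lapse r :=
  Real.sq_sqrt (lapse_pos hr).le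

theorem sqrt_mul_sub_two {r : ℝ} (hr : 2 < r) : √(r * (r - 2)) = r * √(lapse r) := by
  rw [← mul_lapse (by linarith), ← mul_assoc, Real.sqrt_mul (by positivity),
    Real.sqrt_mul_self (by linarith)]

theorem gam_eq {x : ReducedState} (hr : 2 < x.r) : Gam x = √(lapse x.r) * rho x - x.E 1 := by
  rw [Gam, rho, Real.sqrt_mul (lapse_pos hr).le]

theorem massSq_planar (en : ℝ) {x : ReducedState} (hr : 2 < x.r) (hE : x.E 2 = 0)
    (hP : x.Pr = 0) :
    massSq en x = timeMomentum en x ^ 2 - azimuthalMomentum x ^ 2 := by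
  have hr0 : x.r ≠ 0 := by linarith
  have hb : √(lapse x.r) ≠ 0 := (Real.sqrt_pos.2 (lapse_pos hr)).ne'
  have h : x.r ^ 3 * (x.r - 2) = (x.r ^ 2 * √(lapse x.r)) ^ 2 := by
    rw [mul_pow, sqrt_lapse_sq hr, ← mul_lapse hr0]; ring
  rw [massSq, hE, hP, h, timeMomentum, azimuthalMomentum, gam_eq hr]
  ring

/-- The correction term of the Hamiltonian in the planar sector. -/
noncomputable def planarTerm (en : ℝ) (x : ReducedState) : ℝ :=
  (x.Z 0 * timeMomentum en x - x.Z 1 * azimuthalMomentum x) *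
    ((3 * x.E 0 ^ 2 / x.Z 1 ^ 2 - 2) * x.Z 0 * timeMomentum en x
      + (3 * x.E 0 ^ 2 / x.Z 1 ^ 2 - 1) * x.Z 1 * azimuthalMomentum x)

theorem H_planar (en : ℝ) {x : ReducedState} (hr : 2 < x.r) (hZ1 : 0 < x.Z 1)
    (hE0 : x.E 0 ^ 2 < x.Z 1 ^ 2) (hE : x.E 2 = 0) (hZ : x.Z 2 = 0) (hP : x.Pr = 0) :
    H en x = -(timeMomentum en x ^ 2 - azimuthalMomentum x ^ 2) / 2
      + planarTerm en x / V en x := by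
  have hr0 : x.r ≠ 0 := by linarith
  have hb : √(lapse x.r) ≠ 0 := (Real.sqrt_pos.2 (lapse_pos hr)).ne'
  have h : x.r ^ 3 * (x.r - 2) = (x.r ^ 2 * √(lapse x.r)) ^ 2 := by
    rw [mul_pow, sqrt_lapse_sq hr, ← mul_lapse hr0]; ring
  have hrho : x.Z 1 ^ 2 - x.E 0 ^ 2 = rho x ^ 2 := (Real.sq_sqrt (by linarith)).symm
  have hE0' : x.E 0 ^ 2 = x.Z 1 ^ 2 - rho x ^ 2 := by linarith
  have hz : x.Z 1 ≠ 0 := hZ1.ne'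
  rw [H, planarTerm, hE, hZ, hP, h, sqrt_mul_sub_two hr, gam_eq hr, hrho, hE0', timeMomentum,
    azimuthalMomentum, Theta]
  generalize √(lapse x.r) = b at *
  generalize rho x = w at *
  -- The case V = 0, where the quotients are zero by convention, is included so that the formula
  -- holds on a whole neighbourhood without tracking V.
  by_cases hV : V en x = 0
  · rw [hV]; simp; field_simp; ring
  · field_simp
    ring

theorem V_planar (en : ℝ) {x : ReducedState} (hr : 2 < x.r) (hE : x.E 2 = 0) (hZ : x.Z 2 = 0)
    (hP : x.Pr = 0) :
    V en x = (timeMomentum en x ^ 2 - azimuthalMomentum x ^ 2) * x.r ^ 3 - 2 * x.Z 0 ^ 2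
      - x.Z 1 ^ 2 + 3 * x.E 0 ^ 2 * (1 + x.Z 0 ^ 2 / x.Z 1 ^ 2) := by
  rw [V, massSq_planar en hr hE hP, hZ]; ring

/-! ### First derivatives of the Hamiltonian on the planar sector. -/

/-- The derivative of the Hamiltonian in the planar sector, at a point with normalized momentum
`(-z / k, -y / k)`, in terms of the derivatives `f'`, `g'` of this momentum and `y'`, `z'` of
`Z₁`, `Z₂`. -/
noncomputable def planarDeriv (k en : ℝ) (x : ReducedState) (f' g' y' z' : ℝ) : ℝ :=
  (x.Z 1 * f' - x.Z 0 * g') / k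
    - x.Z 0 * x.Z 1 * (6 * x.E 0 ^ 2 / x.Z 1 ^ 2 - 3) / (k * V en x)
      * (x.Z 0 * f' - x.Z 1 * g' - (x.Z 1 * y' - x.Z 0 * z') / k)

/-- The derivative of the Hamiltonian along a curve in the planar sector, at a point with
normalized momentum `(-z / k, -y / k)`. -/
theorem hasDerivAt_H_planar {en : ℝ → ℝ} {x : ℝ → ReducedState} {s f' g' y' z' k : ℝ}
    (hE : ∀ t, (x t).E 2 = 0) (hZ : ∀ t, (x t).Z 2 = 0) (hP : ∀ t, (x t).Pr = 0)
    (hreg : ∀ᶠ t in 𝓝 s, 2 < (x t).r ∧ 0 < (x t).Z 1 ∧ (x t).E 0 ^ 2 < (x t).Z 1 ^ 2)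
    (hf : HasDerivAt (fun t => timeMomentum (en t) (x t)) f' s)
    (hg : HasDerivAt (fun t => azimuthalMomentum (x t)) g' s)
    (hy : HasDerivAt (fun t => (x t).Z 0) y' s) (hz : HasDerivAt (fun t => (x t).Z 1) z' s)
    (he : DifferentiableAt ℝ (fun t => (x t).E 0) s) (hr : DifferentiableAt ℝ (fun t => (x t).r) s)
    (hV : V (en s) (x s) ≠ 0)
    (hfs : timeMomentum (en s) (x s) = -(x s).Z 1 / k)
    (hgs : azimuthalMomentum (x s) = -(x s).Z 0 / k) :
    HasDerivAt (fun t => H (en t) (x t))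
      (planarDeriv k (en s) (x s) f' g' y' z') s := by
  obtain ⟨hrs, hzs, hes⟩ := hreg.self_of_nhds
  have hz2 : (x s).Z 1 ^ 2 ≠ 0 := by positivity
  have hh : DifferentiableAt ℝ (fun t => 3 * (x t).E 0 ^ 2 / (x t).Z 1 ^ 2) s :=
    ((he.pow 2).const_mul 3).div (hz.differentiableAt.pow 2) hz2
  have hVd : DifferentiableAt ℝ (fun t => (timeMomentum (en t) (x t) ^ 2
      - azimuthalMomentum (x t) ^ 2) * (x t).r ^ 3 - 2 * (x t).Z 0 ^ 2
      - (x t).Z 1 ^ 2 + 3 * (x t).E 0 ^ 2 * (1 + (x t).Z 0 ^ 2 / (x t).Z 1 ^ 2)) s := by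
    have h0 := hf.differentiableAt
    have h1 := hg.differentiableAt
    have h2 := hy.differentiableAt
    have h3 := hz.differentiableAt
    fun_prop (disch := assumption)
  have hVe : (fun t => (timeMomentum (en t) (x t) ^ 2
      - azimuthalMomentum (x t) ^ 2) * (x t).r ^ 3 - 2 * (x t).Z 0 ^ 2
      - (x t).Z 1 ^ 2 + 3 * (x t).E 0 ^ 2 * (1 + (x t).Z 0 ^ 2 / (x t).Z 1 ^ 2))
      =ᶠ[𝓝 s] fun t => V (en t) (x t) := by
    filter_upwards [hreg] with t ht
    exact (V_planar (en t) ht.1 (hE t) (hZ t) (hP t)).symm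
  have hVd' := (hVe.differentiableAt_iff.1 hVd).hasDerivAt
  have hh' := hh.hasDerivAt
  -- Only the existence of these two derivatives matters: both are multiplied by the factor Z₁f -
  -- Z₂g, which vanishes at `s`.
  set v' := deriv (fun t => V (en t) (x t)) s
  set h' := deriv (fun t => 3 * (x t).E 0 ^ 2 / (x t).Z 1 ^ 2) s
  have hK : HasDerivAt (fun t => planarTerm (en t) (x t)) _ s :=
    ((hy.mul hf).sub (hz.mul hg)).mul
      ((((hh'.sub_const 2).mul hy).mul hf).add (((hh'.sub_const 1).mul hz).mul hg))
  have hM := (((hf.pow 2).sub (hg.pow 2)).neg.div_const 2).add (hK.div hVd' hV)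
  have hHe : (fun t => H (en t) (x t)) =ᶠ[𝓝 s] fun t =>
      -(timeMomentum (en t) (x t) ^ 2 - azimuthalMomentum (x t) ^ 2) / 2
      + planarTerm (en t) (x t) / V (en t) (x t) := by
    filter_upwards [hreg] with t ht
    exact H_planar (en t) ht.1 ht.2.1 ht.2.2 (hE t) (hZ t) (hP t)
  refine (hM.congr_of_eventuallyEq hHe).congr_deriv ?_
  simp only [planarTerm, planarDeriv, Pi.mul_apply, Pi.sub_apply, Nat.cast_ofNat,
    Nat.reduceSub, pow_one, hfs, hgs]
  generalize V (en s) (x s) = v at *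
  generalize (x s).Z 0 = y
  generalize (x s).Z 1 = z at *
  by_cases hk : k = 0
  · subst hk; simp
  have hz0 : z ≠ 0 := hzs.ne'
  field_simp
  ring

/-- Points of the planar sector with normalized momentum `(-Z₂ / k, -Z₁ / k)`. -/
structure IsPlanarPoint (k en : ℝ) (x : ReducedState) : Prop where
  two_lt : 2 < x.r
  Z1_pos : 0 < x.Z 1
  sq_lt : x.E 0 ^ 2 < x.Z 1 ^ 2
  E2_eq : x.E 2 = 0
  Z2_eq : x.Z 2 = 0
  Pr_eq : x.Pr = 0
  k_ne : k ≠ 0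
  E1_eq : x.E 1 = √(lapse x.r) * rho x + x.r * x.Z 0 / k
  en_eq : en = x.Z 0 * rho x / (x.Z 1 * x.r ^ 2) + √(lapse x.r) * x.Z 1 / k

theorem hasDerivAt_sqrt_lapse {r : ℝ} (hr : 2 < r) :
    HasDerivAt (fun s => √(lapse s)) (1 / (r ^ 2 * √(lapse r))) r := by
  have hr0 : r ≠ 0 := by linarith
  have h : HasDerivAt lapse (2 / r ^ 2) r := by
    have := ((hasDerivAt_inv hr0).const_mul 2).const_sub 1
    refine (this.congr_of_eventuallyEq (.of_forall fun s => ?_)).congr_deriv ?_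
    · simp [lapse, div_eq_mul_inv]
    · field_simp
  refine (h.sqrt (lapse_pos hr).ne').congr_deriv ?_
  field_simp

theorem eventually_sq_lt {e z : ℝ → ℝ} {s : ℝ} (he : ContinuousAt e s) (hz : ContinuousAt z s)
    (h : e s ^ 2 < z s ^ 2) : ∀ᶠ t in 𝓝 s, e t ^ 2 < z t ^ 2 :=
  (he.pow 2).eventually_lt (hz.pow 2) h

/-- The derivative at zero of an even function vanishes. -/
theorem deriv_zero_of_even {f : ℝ → ℝ} (h : ∀ s, f (-s) = f s) : deriv f 0 = 0 := by
  have h1 := deriv_comp_neg f 0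
  rw [funext h, neg_zero] at h1
  linarith

namespace IsPlanarPoint

variable {k en : ℝ} {x : ReducedState} (h : IsPlanarPoint k en x)

include h

theorem lapse_pos : 0 < √(lapse x.r) := Real.sqrt_pos.2 (SpinningBody.lapse_pos h.two_lt)

theorem rho_pos : 0 < rho x := Real.sqrt_pos.2 (sub_pos.2 h.sq_lt)

theorem timeMomentum_eq : timeMomentum en x = -x.Z 1 / k := by
  have hb := h.lapse_pos.ne'
  have hr : x.r ≠ 0 := by linarith [h.two_lt]
  have hz := h.Z1_pos.ne'
  have hk := h.k_ne
  rw [timeMomentum, Theta, h.en_eq]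
  field_simp
  ring

theorem azimuthalMomentum_eq : azimuthalMomentum x = -x.Z 0 / k := by
  have hr : x.r ≠ 0 := by linarith [h.two_lt]
  have hk := h.k_ne
  rw [azimuthalMomentum, h.E1_eq]
  field_simp
  ring

/-- With Z₃ = P_r = 0, the variable E₃ enters only through its square. The same evenness argument
serves for Z₃ and P_r below. -/
theorem gradE_two : gradE en x 2 = 0 := by
  rw [gradE, h.E2_eq]
  refine deriv_zero_of_even fun s => ?_
  simp [H, V, massSq, rho, Theta, Gam, h.Z2_eq, h.Pr_eq]

theorem gradZ_two : gradZ en x 2 = 0 := by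
  rw [gradZ, h.Z2_eq]
  refine deriv_zero_of_even fun s => ?_
  simp [H, V, massSq, rho, Theta, Gam, h.E2_eq, h.Pr_eq]

theorem dHdPr_eq : dHdPr en x = 0 := by
  rw [dHdPr, h.Pr_eq]
  refine deriv_zero_of_even fun s => ?_
  simp [H, V, massSq, rho, Theta, Gam, h.E2_eq, h.Z2_eq]

section Derivatives

variable (hv : V en x ≠ 0)

include hv

theorem gradE_zero : gradE en x 0 = planarDeriv k en x
    (-(x.Z 0 * x.E 0 / (x.Z 1 * x.r ^ 2 * √(lapse x.r) * rho x)))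
    (-(√(lapse x.r) * x.E 0 / (x.r * rho x))) 0 0 := by
  have hrho : HasDerivAt (fun s => √(x.Z 1 ^ 2 - s ^ 2)) (-x.E 0 / rho x) (x.E 0) := by
    have := (((hasDerivAt_id (x.E 0)).pow 2).const_sub (x.Z 1 ^ 2)).sqrt
      (sub_pos.2 h.sq_lt).ne'
    refine this.congr_deriv ?_
    simp [rho]
    field_simp
  have hxs : { x with E := Function.update x.E 0 (x.E 0) } = x := by simp
  have key := hasDerivAt_H_planar (en := fun _ => en)
    (x := fun s => { x with E := Function.update x.E 0 s }) (s := x.E 0) (k := k)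
    (f' := -(x.Z 0 * x.E 0 / (x.Z 1 * x.r ^ 2 * √(lapse x.r) * rho x)))
    (g' := -(√(lapse x.r) * x.E 0 / (x.r * rho x))) (y' := 0) (z' := 0)
    (by simp [h.E2_eq]) (by simp [h.Z2_eq]) (by simp [h.Pr_eq]) ?_ ?_ ?_
    (hasDerivAt_const _ _) (hasDerivAt_const _ _) ?_ (differentiableAt_const _) ?_ ?_ ?_
  · rw [hxs] at key
    exact key.deriv
  · have := eventually_sq_lt (e := fun t => t) (z := fun _ => x.Z 1) (s := x.E 0)
      continuousAt_id continuousAt_const h.sq_lt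
    filter_upwards [this] with t ht
    exact ⟨h.two_lt, h.Z1_pos, by simpa using ht⟩
  · refine (((hrho.const_mul (x.Z 0 / x.Z 1)).sub_const (en * x.r ^ 2)).div_const
      (x.r ^ 2 * √(lapse x.r))).congr_deriv ?_
    field_simp
  · refine (((hrho.const_mul (√(lapse x.r))).sub_const (x.E 1)).div_const x.r).congr_deriv ?_
    field_simp
  · simp
  · simpa using hv
  · simpa using h.timeMomentum_eq
  · simpa using h.azimuthalMomentum_eq

theorem gradE_one : gradE en x 1 = planarDeriv k en x 0 (-(1 / x.r)) 0 0 := by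
  have hxs : { x with E := Function.update x.E 1 (x.E 1) } = x := by simp
  have key := hasDerivAt_H_planar (en := fun _ => en)
    (x := fun s => { x with E := Function.update x.E 1 s }) (s := x.E 1) (k := k)
    (f' := 0) (g' := -(1 / x.r)) (y' := 0) (z' := 0)
    (by simp [h.E2_eq]) (by simp [h.Z2_eq]) (by simp [h.Pr_eq]) ?_ ?_ ?_
    (hasDerivAt_const _ _) (hasDerivAt_const _ _) ?_ (differentiableAt_const _) ?_ ?_ ?_
  · rw [hxs] at key
    exact key.deriv
  · exact .of_forall fun t => ⟨h.two_lt, h.Z1_pos, by simpa using h.sq_lt⟩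
  · simpa [timeMomentum, Theta, rho] using hasDerivAt_const (x.E 1) (timeMomentum en x)
  · simp only [azimuthalMomentum, rho]
    refine ((((hasDerivAt_id (x.E 1)).const_sub
      (√(lapse x.r) * rho x)).div_const x.r).congr_of_eventuallyEq
      (.of_forall fun t => ?_)).congr_deriv ?_
    · simp [rho]
    · ring
  · simp
  · simpa using hv
  · simpa using h.timeMomentum_eq
  · simpa using h.azimuthalMomentum_eq

theorem gradZ_zero : gradZ en x 0 = planarDeriv k en x
    (rho x / (x.Z 1 * x.r ^ 2 * √(lapse x.r))) 0 1 0 := by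
  have hxs : { x with Z := Function.update x.Z 0 (x.Z 0) } = x := by simp
  have key := hasDerivAt_H_planar (en := fun _ => en)
    (x := fun s => { x with Z := Function.update x.Z 0 s }) (s := x.Z 0) (k := k)
    (f' := rho x / (x.Z 1 * x.r ^ 2 * √(lapse x.r))) (g' := 0) (y' := 1) (z' := 0)
    (by simp [h.E2_eq]) (by simp [h.Z2_eq]) (by simp [h.Pr_eq]) ?_ ?_ ?_
    ?_ (hasDerivAt_const _ _) (differentiableAt_const _) (differentiableAt_const _) ?_ ?_ ?_
  · rw [hxs] at key
    exact key.deriv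
  · exact .of_forall fun t => ⟨h.two_lt, by simpa using h.Z1_pos, by simpa using h.sq_lt⟩
  · refine ((((((hasDerivAt_id (x.Z 0)).div_const (x.Z 1)).mul_const (rho x)).sub_const
      (en * x.r ^ 2)).div_const (x.r ^ 2 * √(lapse x.r))).congr_of_eventuallyEq
      (.of_forall fun t => ?_)).congr_deriv ?_
    · simp [timeMomentum, Theta, rho]
    · field_simp
  · simpa [azimuthalMomentum, rho] using hasDerivAt_const (x.Z 0) (azimuthalMomentum x)
  · simpa using hasDerivAt_id' (x.Z 0)
  · simpa using hv
  · simpa using h.timeMomentum_eq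
  · simpa using h.azimuthalMomentum_eq

theorem gradZ_one : gradZ en x 1 = planarDeriv k en x
    ((x.Z 0 / rho x - x.Z 0 * rho x / x.Z 1 ^ 2) / (x.r ^ 2 * √(lapse x.r)))
    (√(lapse x.r) * x.Z 1 / (x.r * rho x)) 0 1 := by
  have hz := h.Z1_pos.ne'
  have hr : x.r ≠ 0 := by linarith [h.two_lt]
  have hb := h.lapse_pos.ne'
  have hw := h.rho_pos.ne'
  have hrho : HasDerivAt (fun s => √(s ^ 2 - x.E 0 ^ 2)) (x.Z 1 / rho x) (x.Z 1) := by
    have := (((hasDerivAt_id (x.Z 1)).pow 2).sub_const (x.E 0 ^ 2)).sqrt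
      (sub_pos.2 h.sq_lt).ne'
    refine this.congr_deriv ?_
    simp [rho]
    field_simp
  have hxs : { x with Z := Function.update x.Z 1 (x.Z 1) } = x := by simp
  have key := hasDerivAt_H_planar (en := fun _ => en)
    (x := fun s => { x with Z := Function.update x.Z 1 s }) (s := x.Z 1) (k := k)
    (f' := (x.Z 0 / rho x - x.Z 0 * rho x / x.Z 1 ^ 2) / (x.r ^ 2 * √(lapse x.r)))
    (g' := √(lapse x.r) * x.Z 1 / (x.r * rho x)) (y' := 0) (z' := 1)
    (by simp [h.E2_eq]) (by simp [h.Z2_eq]) (by simp [h.Pr_eq]) ?_ ?_ ?_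
    (hasDerivAt_const _ _) ?_ (differentiableAt_const _) (differentiableAt_const _) ?_ ?_ ?_
  · rw [hxs] at key
    exact key.deriv
  · have := eventually_sq_lt (e := fun _ => x.E 0) (z := fun t => t) (s := x.Z 1)
      continuousAt_const continuousAt_id h.sq_lt
    filter_upwards [this, lt_mem_nhds h.Z1_pos] with t ht ht'
    exact ⟨h.two_lt, by simpa using ht', by simpa using ht⟩
  · refine ((((((hasDerivAt_const (x.Z 1) (x.Z 0)).div (hasDerivAt_id (x.Z 1)) hz).mul
      hrho).sub_const (en * x.r ^ 2)).div_const (x.r ^ 2 * √(lapse x.r))).congr_of_eventuallyEq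
      (.of_forall fun t => ?_)).congr_deriv ?_
    · simp [timeMomentum, Theta, rho]
    · simp only [Pi.div_apply, id_eq]
      rw [← rho]
      field_simp
      ring
  · refine (((hrho.const_mul (√(lapse x.r))).sub_const (x.E 1)).div_const x.r).congr_deriv ?_
    field_simp
  · simpa using hasDerivAt_id' (x.Z 1)
  · simpa using hv
  · simpa using h.timeMomentum_eq
  · simpa using h.azimuthalMomentum_eq

theorem dHdr_eq : dHdr en x = planarDeriv k en x
    (x.Z 1 / (k * x.r ^ 2 * √(lapse x.r) ^ 2)
      - 2 * x.Z 0 * rho x / (x.Z 1 * x.r ^ 3 * √(lapse x.r)))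
    (rho x / (x.r ^ 3 * √(lapse x.r)) + x.Z 0 / (k * x.r)) 0 0 := by
  have hz := h.Z1_pos.ne'
  have hr : x.r ≠ 0 := by linarith [h.two_lt]
  have hb := h.lapse_pos.ne'
  have hk := h.k_ne
  have hbr := hasDerivAt_sqrt_lapse h.two_lt
  have hid := hasDerivAt_id x.r
  have key := hasDerivAt_H_planar (en := fun _ => en)
    (x := fun s => { x with r := s }) (s := x.r) (k := k)
    (f' := x.Z 1 / (k * x.r ^ 2 * √(lapse x.r) ^ 2)
      - 2 * x.Z 0 * rho x / (x.Z 1 * x.r ^ 3 * √(lapse x.r)))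
    (g' := rho x / (x.r ^ 3 * √(lapse x.r)) + x.Z 0 / (k * x.r)) (y' := 0) (z' := 0)
    (by simp [h.E2_eq]) (by simp [h.Z2_eq]) (by simp [h.Pr_eq]) ?_ ?_ ?_
    (hasDerivAt_const _ _) (hasDerivAt_const _ _) (differentiableAt_const _) differentiableAt_id
    hv h.timeMomentum_eq h.azimuthalMomentum_eq
  · exact key.deriv
  · filter_upwards [lt_mem_nhds h.two_lt] with t ht
    exact ⟨ht, h.Z1_pos, h.sq_lt⟩
  · refine (((((hid.pow 2).const_mul en).const_sub (x.Z 0 / x.Z 1 * rho x)).div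
      ((hid.pow 2).mul hbr) (by simp [hr, hb])).congr_of_eventuallyEq
      (.of_forall fun t => ?_)).congr_deriv ?_
    · simp [timeMomentum, Theta, rho]
    · simp only [Pi.mul_apply, Pi.pow_apply, id_eq, Nat.cast_ofNat, Nat.reduceSub, pow_one]
      rw [h.en_eq]
      field_simp
      ring
  · refine ((((hbr.mul_const (rho x)).sub_const (x.E 1)).div hid hr).congr_of_eventuallyEq
      (.of_forall fun t => ?_)).congr_deriv ?_
    · simp [azimuthalMomentum, rho]
    · simp only [id_eq]
      rw [h.E1_eq]
      field_simp
      ring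

theorem dHden_eq : dHden en x = planarDeriv k en x (-(1 / √(lapse x.r))) 0 0 0 := by
  have hr : x.r ≠ 0 := by linarith [h.two_lt]
  have hb := h.lapse_pos.ne'
  have key := hasDerivAt_H_planar (en := fun t => t) (x := fun _ => x) (s := en) (k := k)
    (f' := -(1 / √(lapse x.r))) (g' := 0) (y' := 0) (z' := 0)
    (fun _ => h.E2_eq) (fun _ => h.Z2_eq) (fun _ => h.Pr_eq)
    (.of_forall fun _ => ⟨h.two_lt, h.Z1_pos, h.sq_lt⟩) ?_ (hasDerivAt_const _ _)
    (hasDerivAt_const _ _) (hasDerivAt_const _ _) (differentiableAt_const _)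
    (differentiableAt_const _) hv h.timeMomentum_eq h.azimuthalMomentum_eq
  · exact key.deriv
  · refine ((((hasDerivAt_id en).mul_const (x.r ^ 2)).const_sub (Theta x)).div_const
      (x.r ^ 2 * √(lapse x.r))).congr_deriv ?_
    field_simp

end Derivatives

end IsPlanarPoint

/-! ### Equilibrium conditions as polynomial equations for √(Z₂² - E₁²). -/

/-- The cubic equation for `√(Z₂² - E₁²)` that the equation of motion of `E` amounts to. -/
def orbitCubic (k b r y z w : ℝ) : ℝ :=
  3 * b * k ^ 3 * w ^ 3 - 3 * w ^ 2 * y * k ^ 2 * r * (r - 1) + 3 * b * r ^ 3 * k * z ^ 2 * w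
    + y * z ^ 2 * r ^ 2 * (k ^ 2 - r ^ 2 * (r - 3))

/-- The quadratic equation for `√(Z₂² - E₁²)`. -/
def orbitQuadratic (k b r y z w : ℝ) : ℝ :=
  3 * k ^ 3 * r * w ^ 2 + 3 * y * z ^ 2 * b * (2 * r ^ 3 + k ^ 2) * w
    - k * r * z ^ 2 * (r ^ 3 + 2 * k ^ 2)

namespace IsPlanarPoint

variable {k en : ℝ} {x : ReducedState} (h : IsPlanarPoint k en x)
  (hk : k ^ 2 = x.Z 1 ^ 2 - x.Z 0 ^ 2)

include h

theorem r_mul_sq : x.r * √(lapse x.r) ^ 2 = x.r - 2 := by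
  rw [sqrt_lapse_sq h.two_lt, mul_lapse (by linarith [h.two_lt])]

theorem E0_sq : x.E 0 ^ 2 = x.Z 1 ^ 2 - rho x ^ 2 := by
  rw [rho, Real.sq_sqrt (sub_pos.2 h.sq_lt).le]; ring

include hk

theorem massSq_eq : massSq en x = 1 := by
  have := h.k_ne
  rw [massSq_planar en h.two_lt h.E2_eq h.Pr_eq, h.timeMomentum_eq, h.azimuthalMomentum_eq]
  field_simp
  linarith

/-- The two groups of terms are kept apart because they are the coefficients that appear in
`planarDeriv_eq`. -/
theorem sq_mul_V : x.Z 1 ^ 2 * V en x = x.Z 1 ^ 2 * (3 * x.Z 1 ^ 2 - 6 * rho x ^ 2)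
    + (x.Z 1 ^ 2 * (x.r ^ 3 - k ^ 2) + 3 * rho x ^ 2 * k ^ 2) := by
  have hz := h.Z1_pos.ne'
  rw [V, h.massSq_eq hk, h.Z2_eq, h.E0_sq, hk]
  field_simp
  ring

variable (hv : V en x ≠ 0)

include hv

theorem planarDeriv_eq (f' g' y' z' : ℝ) : planarDeriv k en x f' g' y' z' =
    ((3 * x.Z 1 ^ 2 - 6 * rho x ^ 2) * (k ^ 2 * f' + x.Z 0 * (x.Z 1 * y' - x.Z 0 * z') / k)
      + (x.Z 1 ^ 2 * (x.r ^ 3 - k ^ 2) + 3 * rho x ^ 2 * k ^ 2) * (f' - x.Z 0 / x.Z 1 * g'))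
      / (k * x.Z 1 * V en x) := by
  have hz := h.Z1_pos.ne'
  have hk0 := h.k_ne
  have hV := h.sq_mul_V hk
  rw [planarDeriv, h.E0_sq]
  generalize V en x = v at *
  generalize rho x = w at *
  generalize x.Z 0 = y at *
  generalize x.Z 1 = z at *
  field_simp
  linear_combination (k * (f' * z - y * g')) * hV
    - (3 * z ^ 2 - 6 * w ^ 2) * f' * z * k * hk

/-- Up to sign, the only component of the E-equation that is not trivially zero in the planar
sector. The factors Z₁ and E₁ split off, so for nonzero values only the cubic remains. -/
theorem gradE_cross : gradE en x 0 * x.E 1 - gradE en x 1 * x.E 0 =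
    -(x.Z 0 * x.E 0 * orbitCubic k √(lapse x.r) x.r (x.Z 0) (x.Z 1) (rho x)
      / (V en x * √(lapse x.r) * k ^ 2 * x.Z 1 ^ 2 * x.r ^ 2 * rho x)) := by
  have hz := h.Z1_pos.ne'
  have hk0 := h.k_ne
  have hb := h.lapse_pos.ne'
  have hw := h.rho_pos.ne'
  have hr : x.r ≠ 0 := by linarith [h.two_lt]
  have hrb := h.r_mul_sq
  rw [h.gradE_zero hv, h.gradE_one hv, h.planarDeriv_eq hk hv, h.planarDeriv_eq hk hv,
    h.E1_eq, orbitCubic]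
  generalize V en x = v at *
  generalize rho x = w at *
  generalize √(lapse x.r) = b at *
  generalize x.Z 0 = y at *
  generalize x.Z 1 = z at *
  generalize x.E 0 = e at *
  generalize x.r = r at *
  field_simp
  linear_combination
    e * y * k * (z ^ 2 * (r ^ 3 - k ^ 2) + 3 * w ^ 2 * k ^ 2) * (b * w * k + y * r) * hrb

theorem dHdr_eq_orbit : dHdr en x =
    (x.Z 0 * orbitCubic k √(lapse x.r) x.r (x.Z 0) (x.Z 1) (rho x)
      - k * orbitQuadratic k √(lapse x.r) x.r (x.Z 0) (x.Z 1) (rho x))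
      / (V en x * √(lapse x.r) ^ 2 * k ^ 2 * x.Z 1 ^ 2 * x.r ^ 3) := by
  have hz := h.Z1_pos.ne'
  have hk0 := h.k_ne
  have hb := h.lapse_pos.ne'
  have hw := h.rho_pos.ne'
  have hr : x.r ≠ 0 := by linarith [h.two_lt]
  have hrb := h.r_mul_sq
  rw [h.dHdr_eq hv, h.planarDeriv_eq hk hv, orbitCubic, orbitQuadratic]
  generalize V en x = v at *
  generalize rho x = w at *
  generalize √(lapse x.r) = b at *
  generalize x.Z 0 = y at *
  generalize x.Z 1 = z at *
  generalize x.r = r at *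
  field_simp
  linear_combination (3 * w ^ 2 * k ^ 2 * r - z ^ 2 * r ^ 4 - 2 * z ^ 2 * k ^ 2 * r) * hk
    - y ^ 2 * r * (z ^ 2 * (r ^ 3 - k ^ 2) + 3 * w ^ 2 * k ^ 2) * hrb

/-- The Z-equation is a combination of the r-equation and the cubic. This dependence is why two
conditions, not three, characterize equilibria. -/
theorem gradZ_cross : gradZ en x 0 * x.Z 1 + gradZ en x 1 * x.Z 0 =
    k * √(lapse x.r) / x.Z 1 * (rho x * dHdr en x
      + (x.Z 1 ^ 2 - rho x ^ 2) * x.Z 0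
          * orbitCubic k √(lapse x.r) x.r (x.Z 0) (x.Z 1) (rho x)
        / (V en x * √(lapse x.r) ^ 2 * k ^ 2 * x.Z 1 ^ 2 * x.r ^ 3 * rho x)) := by
  have hz := h.Z1_pos.ne'
  have hk0 := h.k_ne
  have hb := h.lapse_pos.ne'
  have hw := h.rho_pos.ne'
  have hr : x.r ≠ 0 := by linarith [h.two_lt]
  have hrb := h.r_mul_sq
  rw [h.gradZ_zero hv, h.gradZ_one hv, h.dHdr_eq_orbit hk hv, h.planarDeriv_eq hk hv,
    h.planarDeriv_eq hk hv,
    orbitCubic, orbitQuadratic]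
  generalize V en x = v at *
  generalize rho x = w at *
  generalize √(lapse x.r) = b at *
  generalize x.Z 0 = y at *
  generalize x.Z 1 = z at *
  generalize x.r = r at *
  field_simp
  linear_combination (-2 * w ^ 2 * z ^ 2 * k ^ 3 * r - 3 * w * y * z ^ 4 * b * r ^ 3
      + 3 * w ^ 4 * k ^ 3 * r + 6 * w ^ 3 * y * z ^ 2 * b * r ^ 3 - w ^ 2 * z ^ 2 * k * r ^ 4) * hk
    - y ^ 2 * z ^ 2 * k * r * (z ^ 2 * (r ^ 3 - k ^ 2) + 3 * w ^ 2 * k ^ 2) * hrb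

theorem isEquilibrium_iff (hE : x.E 0 ≠ 0) (hZ : x.Z 0 ≠ 0) : IsEquilibrium en x ↔
    orbitQuadratic k √(lapse x.r) x.r (x.Z 0) (x.Z 1) (rho x) = 0 ∧
      orbitCubic k √(lapse x.r) x.r (x.Z 0) (x.Z 1) (rho x) = 0 := by
  have hz := h.Z1_pos.ne'
  have hk0 := h.k_ne
  have hb := h.lapse_pos.ne'
  have hw := h.rho_pos.ne'
  have hr : x.r ≠ 0 := by linarith [h.two_lt]
  have h1 := h.gradE_cross hk hv
  have h2 := h.dHdr_eq_orbit hk hv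
  have h3 := h.gradZ_cross hk hv
  have e1 : crossProduct (gradE en x) x.E = 0 ↔
      gradE en x 0 * x.E 1 - gradE en x 1 * x.E 0 = 0 := by
    simp [cross_apply, h.gradE_two, h.E2_eq]
  have e2 : crossProduct (gradZ en x) (JZ x.Z) = 0 ↔
      gradZ en x 0 * x.Z 1 + gradZ en x 1 * x.Z 0 = 0 := by
    simp [cross_apply, h.gradZ_two, h.Z2_eq, JZ]
    constructor <;> intro h0 <;> linear_combination -h0
  constructor
  · rintro ⟨-, hE', -, -, hr'⟩
    rw [vectorField] at hE' hr'
    rw [e1, h1, neg_eq_zero, div_eq_zero_iff] at hE'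
    have hc : orbitCubic k √(lapse x.r) x.r (x.Z 0) (x.Z 1) (rho x) = 0 := by
      simpa [hE, hZ, hz, hk0, hb, hw, hr, hv] using hE'
    refine ⟨?_, hc⟩
    simp only [neg_eq_zero] at hr'
    rw [h2, hc] at hr'
    simpa [hE, hZ, hz, hk0, hb, hw, hr, hv] using hr'
  · rintro ⟨hq, hc⟩
    rw [hq, hc] at h2
    rw [hc] at h1 h3
    have h2' : dHdr en x = 0 := by simpa using h2
    rw [h2'] at h3
    refine ⟨⟨h.two_lt, h.Z1_pos, h.sq_lt, hv⟩, e1.2 (by simpa using h1), e2.2 (by simpa using h3),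
      h.dHdPr_eq, by simpa [vectorField] using h2'⟩

theorem U_eq : U en x =
    ((x.Z 0 / x.Z 1 * (x.Z 1 ^ 2 * (x.r ^ 3 - k ^ 2) + 3 * rho x ^ 2 * k ^ 2)) ^ 2
      - (x.Z 1 ^ 2 * (x.r ^ 3 + 2 * k ^ 2) - 3 * rho x ^ 2 * k ^ 2) ^ 2)
      / (k * x.Z 1 * V en x) ^ 2 := by
  have hz := h.Z1_pos.ne'
  have hk0 := h.k_ne
  have hb := h.lapse_pos.ne'
  have hr : x.r ≠ 0 := by linarith [h.two_lt]
  rw [U, h.dHdPr_eq, h.gradE_two, h.gradE_one hv, h.dHden_eq hv, h.planarDeriv_eq hk hv,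
    h.planarDeriv_eq hk hv]
  have hl := sqrt_lapse_sq h.two_lt
  generalize √(lapse x.r) = b at *
  rw [← hl]
  field_simp
  ring

end IsPlanarPoint

/-! ### Elimination, and the signs of V and U. -/

/-- The linear equation for `√(Z₂² - E₁²)`. -/
def orbitLinear (k b r y z w : ℝ) : ℝ :=
  (2 * k ^ 4 * r ^ 3 + 3 * (r - 1) * k ^ 2 * y ^ 2 * r ^ 3
      + 3 * y ^ 2 * z ^ 2 * (r - 2) * (2 * r ^ 3 + k ^ 2)) * w
    - r ^ 2 * b * y * k * (r ^ 3 * k ^ 2 + z ^ 2 * (r ^ 3 + 2 * k ^ 2))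

/-- Polynomial division in w: modulo the quadratic and r b² = r - 2, a nonzero multiple of the cubic
equals a nonzero multiple of the linear form. -/
theorem orbitCubic_eq_zero_iff {k b r y z w : ℝ} (hk : k ≠ 0) (hr : 2 < r) (hb : b ≠ 0)
    (hz : z ≠ 0) (hrb : r * b ^ 2 = r - 2)
    (hq : orbitQuadratic k b r y z w = 0) :
    orbitCubic k b r y z w = 0 ↔ orbitLinear k b r y z w = 0 := by
  have hr0 : r ≠ 0 := by linarith
  have hm : 2 * r ^ 3 + k ^ 2 ≠ 0 := by positivity
  have key : k ^ 3 * r ^ 3 * orbitCubic k b r y z w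
      = b * (2 * r ^ 3 + k ^ 2) * z ^ 2 * orbitLinear k b r y z w := by
    unfold orbitQuadratic at hq
    unfold orbitLinear orbitCubic
    linear_combination (b * w * k ^ 3 * r ^ 2
        - y * (r ^ 3 * (r - 1) * k ^ 2 + z ^ 2 * (r - 2) * (2 * r ^ 3 + k ^ 2))) * hq
      + y * z ^ 2 * k * r * (2 * r ^ 3 + k ^ 2)
        * (r ^ 3 * k ^ 2 + z ^ 2 * (r ^ 3 + 2 * k ^ 2) - 3 * w ^ 2 * k ^ 2) * hrb
  constructor
  · intro h
    rw [h, mul_zero] at key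
    simpa [hb, hm, hz] using key.symm
  · intro h
    rw [h, mul_zero] at key
    simpa [hk, hr0] using key

/-- The bound behind the causality of the velocity on the asymmetric family. -/
theorem lt_three_mul_of_orbit {r b t x C : ℝ} (hr : 2 < r) (hb : 0 < b) (hrb : r * b ^ 2 = r - 2)
    (ht : 0 < t) (ht1 : t < 1) (hx : 0 < x) (hxC : x ^ 2 < C)
    (hq : 3 * r * x ^ 2 * (1 - t ^ 2) + 3 * b * t * (2 * r ^ 3 + C) * x
      = r * (r ^ 3 + 2 * C) * (1 - t ^ 2))
    (hc : 3 * b * x ^ 3 + 3 * b * r ^ 3 * x - 3 * x ^ 2 * t * r * (r - 1)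
      + t * r ^ 2 * (C - r ^ 2 * (r - 3)) = 0) :
    r * (1 - t) < 3 * b * x := by
  have ht2 : 0 < 1 - t ^ 2 := sub_pos.2 (pow_lt_one₀ ht.le ht1 two_ne_zero)
  have ht' : 0 < 1 - t := sub_pos.2 ht1
  have hr0 : 0 < r := by linarith
  have hr3 : 0 < r ^ 3 := by positivity
  have hC : 0 < C := (by positivity : (0 : ℝ) < x ^ 2).trans hxC
  have hm : 0 < 2 * r ^ 3 + C := by positivity
  -- Combining the two equations so that the terms in x² cancel leaves a manifestly positive
  -- difference.
  have h1 : 3 * x * (x ^ 2 + r ^ 3) < t * r ^ 2 * b * (2 * r ^ 3 + C) := by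
    have h2 : b * (1 - t ^ 2) * (t * r ^ 2 * b * (2 * r ^ 3 + C) - 3 * x * (x ^ 2 + r ^ 3))
        = 3 * (r - 1) * b * t ^ 2 * (2 * r ^ 3 + C) * x := by
      linear_combination (-(1 - t ^ 2)) * hc + t * (1 - t ^ 2) * r * (2 * r ^ 3 + C) * hrb
        - t * (r - 1) * hq
    have h3 : 0 < 3 * (r - 1) * b * t ^ 2 * (2 * r ^ 3 + C) * x := by
      have : 0 < r - 1 := by linarith
      positivity
    rw [← h2] at h3
    exact sub_pos.1 ((mul_pos_iff_of_pos_left (by positivity)).1 h3)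
  -- If 3bx ≤ r(1 - t), the previous bound gives an upper estimate for x² and the quadratic a lower
  -- one; with x² < C they are incompatible.
  by_contra! h
  have h3 : 9 * x ^ 2 < t * (1 - t) * (2 * r ^ 3 + C) := by
    have h3 : 3 * b * x * (3 * x * (x ^ 2 + r ^ 3))
        ≤ r * (1 - t) * (t * r ^ 2 * b * (2 * r ^ 3 + C)) :=
      mul_le_mul h h1.le (by positivity) (by positivity)
    have h4 : 0 < b * (9 * x ^ 4) := by positivity
    refine lt_of_mul_lt_mul_right (a := b * r ^ 3) ?_ (by positivity)
    linarith
  have h4 : r ^ 3 * (1 - t) + C * (2 + t) ≤ 3 * x ^ 2 * (1 + t) := by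
    have h5 : 3 * b * x * (t * (2 * r ^ 3 + C)) ≤ r * (1 - t) * (t * (2 * r ^ 3 + C)) :=
      mul_le_mul_of_nonneg_right h (by positivity)
    refine le_of_mul_le_mul_left (a := r * (1 - t)) ?_ (by positivity)
    linarith
  have h5 := mul_lt_mul_of_pos_right h3 (by linarith : 0 < 1 + t)
  have h6 := mul_lt_mul_of_pos_right hxC (by linarith : 0 < 1 + t)
  have h7 : 0 ≤ t * C * t ^ 2 := by positivity
  have h8 : 0 ≤ r ^ 3 * (1 - t) * (1 - t) := by positivity
  have h9 : 0 ≤ r ^ 3 * (1 - t) * (1 - t) * t := by positivity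
  linarith

theorem orbit_mul_eq {c b r y z w : ℝ} (hq : orbitQuadratic c b r y z w = 0) :
    c * r * (z ^ 2 * (r ^ 3 + 2 * c ^ 2) - 3 * w ^ 2 * c ^ 2)
    = 3 * y * z ^ 2 * b * (2 * r ^ 3 + c ^ 2) * w := by
  unfold orbitQuadratic at hq
  linear_combination -hq

section

variable {c b r y z w : ℝ} (hr : 2 < r) (hb : 0 < b) (hrb : r * b ^ 2 = r - 2) (hc : 0 < c)
  (hy : 0 < y) (hw : 0 < w) (hwz : w < z) (hcz : c ^ 2 = z ^ 2 - y ^ 2)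
  (hq : orbitQuadratic c b r y z w = 0) (hl : orbitCubic c b r y z w = 0)

include hr hb hrb hc hy hw hwz hcz hq hl

/-- The homogeneous variables are t = y/z and x = cw/z, with C = c². The hypothesis w < z becomes x²
< C. -/
theorem orbit_sub_lt : r * (z - y) < 3 * b * c * w := by
  have hz : 0 < z := hw.trans hwz
  have hr0 : 0 < r := by linarith
  have hyz : y < z := by
    refine lt_of_pow_lt_pow_left₀ 2 hz.le ?_
    have : 0 < c ^ 2 := by positivity
    linarith
  have h := lt_three_mul_of_orbit (t := y / z) (x := c * w / z) (C := c ^ 2) hr hb hrb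
    (by positivity) ((div_lt_one hz).2 hyz) (by positivity) ?_ ?_ ?_
  · field_simp at h
    exact h
  · rw [div_pow, div_lt_iff₀ (by positivity), mul_pow]
    have := pow_lt_pow_left₀ hwz hw.le two_ne_zero
    gcongr
  · unfold orbitQuadratic at hq
    field_simp
    rw [← hcz]
    linear_combination c * hq
  · unfold orbitCubic at hl
    field_simp
    linear_combination hl

theorem orbit_V_pos : 0 < z ^ 2 * (3 * z ^ 2 - 6 * w ^ 2)
    + (z ^ 2 * (r ^ 3 - c ^ 2) + 3 * w ^ 2 * c ^ 2) := by
  have hz : 0 < z := hw.trans hwz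
  have hr0 : 0 < r := by linarith
  have h1 := orbit_sub_lt hr hb hrb hc hy hw hwz hcz hq hl
  have h2 := orbit_mul_eq hq
  have hm : 0 < 2 * r ^ 3 + c ^ 2 := by positivity
  have h3 : r * c ^ 2 * y < 3 * b * c * w * (z ^ 2 + y ^ 2) := by
    have h4 := mul_lt_mul_of_pos_right h1 (by positivity : 0 < z ^ 2 + y ^ 2)
    -- This square is the slack: (z - y)(z² + y²) - (z² - y²)y = z(z - y)².
    have h5 : 0 ≤ r * z * (z - y) ^ 2 := by positivity
    rw [hcz]
    linarith
  have h4 : c ^ 3 * r * (z ^ 2 * (3 * z ^ 2 - 6 * w ^ 2)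
      + (z ^ 2 * (r ^ 3 - c ^ 2) + 3 * w ^ 2 * c ^ 2))
      = y * z ^ 2 * (2 * r ^ 3 + c ^ 2) / c
        * (3 * b * c * w * (z ^ 2 + y ^ 2) - r * c ^ 2 * y) := by
    field_simp
    linear_combination (z ^ 2 + y ^ 2) * h2
      + c * r * (c ^ 2 * (3 * w ^ 2 - z ^ 2) + z ^ 2 * r ^ 3) * hcz
  have h5 : 0 < y * z ^ 2 * (2 * r ^ 3 + c ^ 2) / c
        * (3 * b * c * w * (z ^ 2 + y ^ 2) - r * c ^ 2 * y) :=
    mul_pos (by positivity) (by linarith)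
  rw [← h4] at h5
  exact (mul_pos_iff_of_pos_left (by positivity)).1 h5

theorem orbit_U_neg : (y / z * (z ^ 2 * (r ^ 3 - c ^ 2) + 3 * w ^ 2 * c ^ 2)) ^ 2
    < (z ^ 2 * (r ^ 3 + 2 * c ^ 2) - 3 * w ^ 2 * c ^ 2) ^ 2 := by
  have hz : 0 < z := hw.trans hwz
  have hr0 : 0 < r := by linarith
  have hyz : y < z := by
    refine lt_of_pow_lt_pow_left₀ 2 hz.le ?_
    have : 0 < c ^ 2 := by positivity
    linarith
  have h1 := orbit_sub_lt hr hb hrb hc hy hw hwz hcz hq hl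
  have h2 := orbit_mul_eq hq
  have hm : 0 < 2 * r ^ 3 + c ^ 2 := by positivity
  -- With u the timelike term and M = z²(2r³ + c²), the claim becomes |y(M - u)| < zu. One side
  -- follows from y < z and u > 0, the other from yM < (z + y)u, which is `orbit_sub_lt` multiplied
  -- by z + y.
  have hQ : z ^ 2 * (r ^ 3 - c ^ 2) + 3 * w ^ 2 * c ^ 2 = z ^ 2 * (2 * r ^ 3 + c ^ 2)
      - (z ^ 2 * (r ^ 3 + 2 * c ^ 2) - 3 * w ^ 2 * c ^ 2) := by ring
  rw [hQ]
  generalize z ^ 2 * (r ^ 3 + 2 * c ^ 2) - 3 * w ^ 2 * c ^ 2 = u at *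
  have hu : 0 < u := by
    have : 0 < 3 * y * z ^ 2 * b * (2 * r ^ 3 + c ^ 2) * w := by positivity
    rw [← h2] at this
    exact (mul_pos_iff_of_pos_left (by positivity)).1 this
  refine sq_lt_sq' ?_ ?_
  · rw [div_mul_eq_mul_div, lt_div_iff₀ hz]
    have : 0 < y * (z ^ 2 * (2 * r ^ 3 + c ^ 2)) := by positivity
    have := mul_lt_mul_of_pos_right hyz hu
    linarith
  · rw [div_mul_eq_mul_div, div_lt_iff₀ hz]
    have h3 := mul_lt_mul_of_pos_right h1
      (by positivity : 0 < (z + y) * (y * z ^ 2 * (2 * r ^ 3 + c ^ 2)))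
    have h4 : c ^ 2 * r * (y * (z ^ 2 * (2 * r ^ 3 + c ^ 2))) < c ^ 2 * r * (u * (z + y)) := by
      calc _ = r * (z - y) * ((z + y) * (y * z ^ 2 * (2 * r ^ 3 + c ^ 2))) := by rw [hcz]; ring
        _ < _ := h3
        _ = _ := by linear_combination (-c * (z + y)) * h2
    have := lt_of_mul_lt_mul_left h4 (by positivity)
    linarith

end

/-! ### The parameter system in terms of W. -/

/-- The second parameter equation before the square root is inserted: the first factor stands for
√(3ζ)/√r, which makes the expression linear in w. -/
theorem orbitLinear_identity (c b r y z w : ℝ) (hz : z ≠ 0)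
    (hcz : c ^ 2 = z ^ 2 - y ^ 2) :
    z * (6 * r * c ^ 3 * w / z + 3 * z * b * (2 * r ^ 3 + c ^ 2) * y) / 2
        * (z ^ 2 * (r - 2) * (c ^ 4 - (2 * r ^ 3 + c ^ 2) * z ^ 2)
          + c ^ 2 * r ^ 3 * ((r - 3) * z ^ 2 + c ^ 2 * (r - 5 / 3)))
      + b * y * (z ^ 2 * (3 * z ^ 2 * (r - 2) * (2 * r ^ 3 + c ^ 2) ^ 2 * y ^ 2
            + 4 * c ^ 4 * r ^ 3 * (r ^ 3 + 2 * c ^ 2)) / 2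
          + c ^ 2 * r ^ 3 * z ^ 2 / 2 * (2 * r ^ 3 + c ^ 2) * (3 * y ^ 2 * (r - 1) - 2 * c ^ 2)
          + c ^ 4 * r ^ 6 * (c ^ 2 + 3 * z ^ 2))
      = -(r * c ^ 3) * orbitLinear c b r y z w := by
  have : y ^ 2 = z ^ 2 - c ^ 2 := by linarith
  unfold orbitLinear
  field_simp
  rw [this]
  ring

section Parameters

variable {c en r z : ℝ} (hc : 0 < c) (hp : ParameterRange c en r z)

include hc hp

theorem ParameterRange.z_pos : 0 < z := hc.trans hp.2.1

theorem ParameterRange.sub_pos : 0 < z ^ 2 - c ^ 2 :=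
  _root_.sub_pos.2 (pow_lt_pow_left₀ hp.2.1 hc.le two_ne_zero)

theorem ParameterRange.sqrt_pos : 0 < √(z ^ 2 - c ^ 2) := Real.sqrt_pos.2 (hp.sub_pos hc)

theorem ParameterRange.sq_eq : c ^ 2 = z ^ 2 - √(z ^ 2 - c ^ 2) ^ 2 := by
  rw [Real.sq_sqrt (hp.sub_pos hc).le]; ring

omit hc in
theorem ParameterRange.lapse_pos : 0 < √(lapse r) := Real.sqrt_pos.2 (SpinningBody.lapse_pos hp.1)

theorem ParameterRange.en_eq : en = √(z ^ 2 - c ^ 2) * orbitW c en r z / (z * r ^ 2)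
    + √(lapse r) * z / c := by
  have hz := (hp.z_pos hc).ne'
  have hy := (hp.sqrt_pos hc).ne'
  have hr : r ≠ 0 := by linarith [hp.1]
  rw [orbitW]
  field_simp
  ring

theorem ParameterRange.orbitE2_eq : orbitE2 c en r z =
    √(lapse r) * orbitW c en r z + r * √(z ^ 2 - c ^ 2) / c := by
  have hz := (hp.z_pos hc).ne'
  have hy := (hp.sqrt_pos hc).ne'
  have hb := hp.lapse_pos.ne'
  have hr : r ≠ 0 := by linarith [hp.1]
  have he := hp.en_eq hc
  rw [orbitE2]
  generalize orbitW c en r z = w at *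
  have hy2 := Real.sq_sqrt (hp.sub_pos hc).le
  generalize √(z ^ 2 - c ^ 2) = y at *
  subst he
  field_simp
  linear_combination (c * w) * hy2

omit hc in
theorem rho_N2 {sgn : ℝ} (hs : sgn = 1 ∨ sgn = -1) :
    rho (N2 sgn c en r z) = |orbitW c en r z| := by
  have hs2 : sgn ^ 2 = 1 := by rcases hs with h | h <;> norm_num [h]
  simp only [rho, N2, Matrix.cons_val_zero, Matrix.cons_val_one]
  rw [mul_pow, hs2, Real.sq_sqrt (_root_.sub_pos.2 hp.2.2).le, ← Real.sqrt_sq_eq_abs]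
  congr 1; ring

omit hc in
theorem N2_E0_sq {sgn : ℝ} (hs : sgn = 1 ∨ sgn = -1) :
    (N2 sgn c en r z).E 0 ^ 2 = z ^ 2 - orbitW c en r z ^ 2 := by
  have hs2 : sgn ^ 2 = 1 := by rcases hs with h | h <;> norm_num [h]
  simp only [N2, Matrix.cons_val_zero]
  rw [mul_pow, hs2, Real.sq_sqrt (_root_.sub_pos.2 hp.2.2).le, one_mul]

/-- The quadratic says r T² = 3ζ for the affine function T of w below. The first parameter equation
selects the root with √r T = √(3ζ), which is the one with w > 0. -/
theorem parameterSystem_iff : ParameterSystem c en r z ↔ 0 < orbitW c en r z ∧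
    orbitQuadratic c √(lapse r) r √(z ^ 2 - c ^ 2) z (orbitW c en r z) = 0 ∧
    orbitLinear c √(lapse r) r √(z ^ 2 - c ^ 2) z (orbitW c en r z) = 0 := by
  have hz := hp.z_pos hc
  have hy := hp.sqrt_pos hc
  have hb := hp.lapse_pos
  have hr2 := hp.1
  have hr : 0 < r := by linarith
  have he := hp.en_eq hc
  have hy2 := Real.sq_sqrt (hp.sub_pos hc).le
  have hrb : r * √(lapse r) ^ 2 = r - 2 := by rw [sqrt_lapse_sq hr2, mul_lapse hr.ne']
  have hq : 0 < √r := Real.sqrt_pos.2 hr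
  have hq2 : √r ^ 2 = r := Real.sq_sqrt hr.le
  have hzeta : 0 < zeta c r z := by
    have h1 := hp.sub_pos hc
    have h2 : 0 < r - 2 := by linarith
    unfold zeta
    positivity
  have hpow : r ^ (7 / 2 : ℝ) = r ^ 3 * √r := by
    rw [show (7 / 2 : ℝ) = 3 + 1 / 2 by norm_num, Real.rpow_add hr, ← Real.sqrt_eq_rpow]
    norm_cast
  have hr2' : √(r - 2) = √r * √(lapse r) := by
    rw [← mul_lapse hr.ne', Real.sqrt_mul hr.le]
  have hS : √(3 * zeta c r z * (z ^ 2 - c ^ 2)) = √(3 * zeta c r z) * √(z ^ 2 - c ^ 2) :=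
    Real.sqrt_mul (by positivity) _
  have hR : √((r - 2) * (z ^ 2 - c ^ 2)) = √r * √(lapse r) * √(z ^ 2 - c ^ 2) := by
    rw [Real.sqrt_mul (by linarith), hr2']
  have hcz := hp.sq_eq hc
  rw [ParameterSystem, hpow, hS, hR, hr2']
  generalize hw : orbitW c en r z = w at *
  have hS2 : √(3 * zeta c r z) ^ 2 = 3 * zeta c r z := Real.sq_sqrt (by positivity)
  have hS0 : 0 < √(3 * zeta c r z) := Real.sqrt_pos.2 (by positivity)
  have hzd : zeta c r z = 3 * z ^ 2 * (r - 2) * (2 * r ^ 3 + c ^ 2) ^ 2 * √(z ^ 2 - c ^ 2) ^ 2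
      + 4 * c ^ 4 * r ^ 3 * (r ^ 3 + 2 * c ^ 2) := by rw [zeta, hy2]
  generalize √(3 * zeta c r z) = S at *
  generalize √r = q at *
  generalize √(lapse r) = b at *
  generalize √(z ^ 2 - c ^ 2) = y at *
  rw [← hy2]
  set T := 6 * r * c ^ 3 * w / z + 3 * z * b * (2 * r ^ 3 + c ^ 2) * y with hT
  have e1 : 6 * (r ^ 3 * q) * c ^ 3 * en - S * y
      - 3 * z * (q * b) * (2 * c ^ 2 * r ^ 3 - (2 * r ^ 3 + c ^ 2) * y ^ 2) = y * (q * T - S) := by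
    rw [he, hT]
    field_simp
    ring
  have hquad : z ^ 2 * (r * T ^ 2 - 3 * zeta c r z)
      = 12 * c ^ 3 * r ^ 2 * orbitQuadratic c b r y z w := by
    rw [hT, hzd, orbitQuadratic]
    field_simp
    linear_combination (9 * z ^ 4 * (2 * r ^ 3 + c ^ 2) ^ 2 * y ^ 2) * hrb
  have hid := orbitLinear_identity c b r y z w hz.ne' hcz
  rw [← hT, ← hzd] at hid
  rw [e1, mul_eq_zero, or_iff_right hy.ne', sub_eq_zero]
  have hquad0 : q * T = S → orbitQuadratic c b r y z w = 0 := by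
    intro h
    have : r * T ^ 2 - 3 * zeta c r z = 0 := by
      rw [← hS2, ← h, ← hq2]; ring
    rw [this, mul_zero] at hquad
    have : 12 * c ^ 3 * r ^ 2 ≠ 0 := by positivity
    simpa [this, hc.ne', hr.ne'] using hquad.symm
  have hlin : q * T = S → z * S / 2
        * (z ^ 2 * (r - 2) * (c ^ 4 - (2 * r ^ 3 + c ^ 2) * z ^ 2)
          + c ^ 2 * r ^ 3 * ((r - 3) * z ^ 2 + c ^ 2 * (r - 5 / 3)))
      + q * b * y * (z ^ 2 * zeta c r z / 2
          + c ^ 2 * r ^ 3 * z ^ 2 / 2 * (2 * r ^ 3 + c ^ 2) * (3 * y ^ 2 * (r - 1) - 2 * c ^ 2)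
          + c ^ 4 * r ^ 6 * (c ^ 2 + 3 * z ^ 2))
      = -(q * r * c ^ 3) * orbitLinear c b r y z w := by
    intro h
    rw [← h]
    linear_combination q * hid
  constructor
  · rintro ⟨-, h1, h2⟩
    rw [hlin h1] at h2
    have hQ := hquad0 h1
    refine ⟨?_, hQ, by simpa [hc.ne', hr.ne', hq.ne'] using h2⟩
    -- For w ≤ 0 the positive number T is at most its constant term, whose square times r is smaller
    -- than 3ζ.
    by_contra! hw0
    have hT0 : 0 < T := (mul_pos_iff_of_pos_left hq).1 (h1 ▸ hS0)
    have hT1 : T ≤ 3 * z * b * (2 * r ^ 3 + c ^ 2) * y := by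
      have : 6 * r * c ^ 3 * w / z ≤ 0 :=
        div_nonpos_of_nonpos_of_nonneg (mul_nonpos_of_nonneg_of_nonpos (by positivity) hw0) hz.le
      linarith
    have hT2 := pow_le_pow_left₀ hT0.le hT1 2
    rw [hQ, mul_zero, mul_eq_zero, or_iff_right (by positivity), hzd] at hquad
    have := mul_le_mul_of_nonneg_left hT2 hr.le
    have h3 : 0 < 4 * c ^ 4 * r ^ 3 * (r ^ 3 + 2 * c ^ 2) := by positivity
    have h4 : r * (3 * z * b * (2 * r ^ 3 + c ^ 2) * y) ^ 2
        = 9 * z ^ 2 * (r - 2) * (2 * r ^ 3 + c ^ 2) ^ 2 * y ^ 2 := by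
      linear_combination (9 * z ^ 2 * (2 * r ^ 3 + c ^ 2) ^ 2 * y ^ 2) * hrb
    linarith
  · rintro ⟨hw0, hQ, hL⟩
    have h1 : q * T = S := by
      have hT0 : 0 < T := by rw [hT]; positivity
      rw [hQ, mul_zero, mul_eq_zero, or_iff_right (by positivity)] at hquad
      refine (pow_left_inj₀ (by positivity) hS0.le two_ne_zero).1 ?_
      rw [mul_pow, hq2, hS2]
      linarith
    refine ⟨hzeta, h1, ?_⟩
    rw [hlin h1, hL, mul_zero]

end Parameters

/-! ### Relative equilibria among the points of the family. -/

theorem isPlanarPoint_N2 {sgn c en r z : ℝ} (hs : sgn = 1 ∨ sgn = -1) (hc : 0 < c)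
    (hp : ParameterRange c en r z) (hw : 0 < orbitW c en r z) :
    IsPlanarPoint c en (N2 sgn c en r z) where
  two_lt := hp.1
  Z1_pos := hp.z_pos hc
  sq_lt := by
    rw [N2_E0_sq hp hs]
    simpa [N2] using pow_pos hw 2
  E2_eq := rfl
  Z2_eq := rfl
  Pr_eq := rfl
  k_ne := hc.ne'
  E1_eq := by
    rw [rho_N2 hp hs, abs_of_pos hw]
    exact hp.orbitE2_eq hc
  en_eq := by
    rw [rho_N2 hp hs, abs_of_pos hw]
    exact hp.en_eq hc

theorem N2_E0_ne_zero {sgn c en r z : ℝ} (hs : sgn = 1 ∨ sgn = -1)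
    (hp : ParameterRange c en r z) : (N2 sgn c en r z).E 0 ≠ 0 := by
  intro h
  have := N2_E0_sq hp hs
  rw [h] at this
  linarith [hp.2.2]

theorem IsPlanarPoint.onTulczyjew {k en : ℝ} {x : ReducedState} (h : IsPlanarPoint k en x) :
    OnTulczyjew en x := by
  have hz := h.Z1_pos.ne'
  have hk0 := h.k_ne
  have hb := h.lapse_pos.ne'
  have hr : x.r ≠ 0 := by linarith [h.two_lt]
  refine ⟨by simp [h.E2_eq, h.Z2_eq, h.Pr_eq], ?_⟩
  rw [gam_eq h.two_lt, Theta, h.E1_eq, h.en_eq]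
  field_simp
  ring

/-- There are no relative equilibria among the points `N₂^±` with `W ≤ 0`. -/
theorem orbitW_pos_of_isRelativeEquilibrium {sgn c en r z : ℝ} (hs : sgn = 1 ∨ sgn = -1)
    (hc : 0 < c) (hp : ParameterRange c en r z)
    (h : IsRelativeEquilibrium c en (N2 sgn c en r z)) : 0 < orbitW c en r z := by
  obtain ⟨-, hm, ⟨-, hT⟩, hE, -⟩ := h
  obtain ⟨-, -, hsq, hv⟩ := hE.1
  rw [N2_E0_sq hp hs] at hsq
  have hw0 : orbitW c en r z ≠ 0 := by
    intro h0
    simp [h0, N2] at hsq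
  by_contra! hneg
  have hneg := lt_of_le_of_ne hneg hw0
  have hz := hp.z_pos hc
  have hy := hp.sqrt_pos hc
  have hb := hp.lapse_pos
  have hr2 := hp.1
  have hr : 0 < r := by linarith
  have hrb : r * √(lapse r) ^ 2 = r - 2 := by rw [sqrt_lapse_sq hr2, mul_lapse hr.ne']
  have hrho := rho_N2 hp hs
  rw [abs_of_neg hneg] at hrho
  have hcz := hp.sq_eq hc
  have he := hp.en_eq hc
  have hE2 := hp.orbitE2_eq hc
  have hwz := hp.2.2
  rw [massSq_planar en (x := N2 sgn c en r z) hr2 rfl rfl, timeMomentum, azimuthalMomentum, Theta,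
    hrho] at hm
  rw [gam_eq (x := N2 sgn c en r z) hr2, Theta, hrho] at hT
  have hE1' : (N2 sgn c en r z).E 1 = orbitE2 c en r z := rfl
  rw [hE1', hE2] at hT hm
  simp only [N2, Matrix.cons_val_zero, Matrix.cons_val_one] at hT hm
  have hsqlt : (N2 sgn c en r z).E 0 ^ 2 < (N2 sgn c en r z).Z 1 ^ 2 := by
    rw [N2_E0_sq hp hs]; exact hsq
  -- The radical in the reduced variables is |W| = -W, so the second Tulczyjew relation and m² = 1
  -- are no longer identities. They leave these two constraints.
  have hcond : √(z ^ 2 - c ^ 2) ^ 2 = r * √(lapse r) ^ 2 * z ^ 2 ∧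
      -orbitW c en r z = r * √(z ^ 2 - c ^ 2) / (c * √(lapse r)) := by
    clear hv hE hrho hE1' hE2 hsqlt hwz hsq
    generalize orbitW c en r z = w at *
    generalize √(z ^ 2 - c ^ 2) = y at *
    generalize √(lapse r) = b at *
    have h1 : y ^ 2 = r * b ^ 2 * z ^ 2 := by
      have h2 : 2 * w ^ 2 * (y ^ 2 - r * b ^ 2 * z ^ 2) / (z ^ 2 * r ^ 2) = 0 := by
        rw [← hT, he]
        field_simp
        ring
      have h3 : y ^ 2 - r * b ^ 2 * z ^ 2 = 0 := by
        simpa [hz.ne', hr.ne', hw0] using h2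
      linarith
    refine ⟨h1, ?_⟩
    have h3 : 0 < 1 - r * b ^ 2 := by
      refine (mul_pos_iff_of_pos_left (pow_pos hz 2)).1 ?_
      have : 0 < c ^ 2 := by positivity
      linarith
    have h2 : 4 * w * (1 - r * b ^ 2) / r ^ 3 * (w + y * r / (b * c)) = 0 := by
      rw [← sub_eq_zero.2 hm, he]
      field_simp
      linear_combination (-4 * w ^ 2 * c ^ 2) * h1 + r ^ 4 * b ^ 2 * z ^ 2 * hcz
    have h4 : w + y * r / (b * c) = 0 := by
      simpa [hr.ne', hw0, h3.ne'] using h2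
    linear_combination -h4
  obtain ⟨hyb, hwv⟩ := hcond
  -- The constraints turn the point into one with the opposite sign of k, to which the equilibrium
  -- criterion applies.
  have hpl : IsPlanarPoint (-c) en (N2 sgn c en r z) := by
    refine ⟨hr2, hz, hsqlt, rfl, rfl, rfl, neg_ne_zero.2 hc.ne', ?_, ?_⟩
    · rw [hE1', hE2, hrho, show orbitW c en r z = -(-orbitW c en r z) by ring, hwv]
      simp only [N2, Matrix.cons_val_zero]
      field_simp
      ring
    · have hwv' : orbitW c en r z = -(r * √(z ^ 2 - c ^ 2) / (c * √(lapse r))) := by linarith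
      rw [hwv'] at he
      rw [hrho, hwv, he]
      simp only [N2, Matrix.cons_val_zero, Matrix.cons_val_one]
      field_simp
      linear_combination -2 * hyb
  have hq := ((hpl.isEquilibrium_iff (by rw [neg_sq]; exact hcz) hv (N2_E0_ne_zero hs hp)
    hy.ne').1 hE).1
  rw [hrho, orbitQuadratic] at hq
  simp only [N2, Matrix.cons_val_zero, Matrix.cons_val_one] at hq
  rw [← neg_sq, hwv] at hwz
  rw [hwv] at hq
  generalize √(z ^ 2 - c ^ 2) = y at *
  generalize √(lapse r) = b at *
  -- This is W² < z² after inserting both constraints; it makes all terms of the quadratic have one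
  -- sign.
  have h1 : r ^ 3 < c ^ 2 := by
    rw [div_pow, div_lt_iff₀ (by positivity), mul_pow, hyb] at hwz
    refine lt_of_mul_lt_mul_right (a := z ^ 2 * b ^ 2) ?_ (by positivity)
    linarith
  have h2 : 2 * c * (c ^ 2 - r ^ 3) + 3 * y ^ 2 * (2 * r ^ 3 + c ^ 2) / c = 0 := by
    field_simp at hq ⊢
    refine mul_left_cancel₀ (by positivity : r * b ^ 2 * z ^ 2 ≠ 0) ?_
    linear_combination hq + 3 * r ^ 3 * c ^ 2 * hyb
  have h3 : 0 < 2 * c * (c ^ 2 - r ^ 3) := mul_pos (by linarith) (by linarith)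
  have h4 : 0 < 3 * y ^ 2 * (2 * r ^ 3 + c ^ 2) / c := by positivity
  linarith

theorem isRelativeEquilibrium_N2_iff {sgn c en r z : ℝ} (hs : sgn = 1 ∨ sgn = -1) (hc : 0 < c)
    (hp : ParameterRange c en r z) :
    IsRelativeEquilibrium c en (N2 sgn c en r z) ↔ ParameterSystem c en r z := by
  have hr2 := hp.1
  have hz := hp.z_pos hc
  have hy := hp.sqrt_pos hc
  have hb := hp.lapse_pos
  have hcz := hp.sq_eq hc
  have hrb : r * √(lapse r) ^ 2 = r - 2 := by rw [sqrt_lapse_sq hr2, mul_lapse (by linarith)]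
  rw [parameterSystem_iff hc hp]
  constructor
  · intro h
    have hw := orbitW_pos_of_isRelativeEquilibrium hs hc hp h
    have hpl := isPlanarPoint_N2 hs hc hp hw
    have hq := (hpl.isEquilibrium_iff hcz h.2.2.2.1.1.2.2.2 (N2_E0_ne_zero hs hp) hy.ne').1
      h.2.2.2.1
    rw [rho_N2 hp hs, abs_of_pos hw] at hq
    simp only [N2, Matrix.cons_val_zero, Matrix.cons_val_one] at hq
    exact ⟨hw, hq.1, (orbitCubic_eq_zero_iff hc.ne' hr2 hb.ne' hz.ne' hrb hq.1).1 hq.2⟩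
  · rintro ⟨hw, hq, hl⟩
    rw [← orbitCubic_eq_zero_iff hc.ne' hr2 hb.ne' hz.ne' hrb hq] at hl
    have hpl := isPlanarPoint_N2 hs hc hp hw
    have hrho := rho_N2 hp hs
    rw [abs_of_pos hw] at hrho
    have hwz : orbitW c en r z < z := lt_of_pow_lt_pow_left₀ 2 hz.le hp.2.2
    have hV := orbit_V_pos hr2 hb hrb hc hy hw hwz hcz hq hl
    have hU := orbit_U_neg hr2 hb hrb hc hy hw hwz hcz hq hl
    have hv : V en (N2 sgn c en r z) ≠ 0 := by
      have := hpl.sq_mul_V hcz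
      rw [hrho] at this
      intro h0
      rw [h0, mul_zero] at this
      exact hV.ne this
    refine ⟨?_, hpl.massSq_eq hcz, hpl.onTulczyjew,
      (hpl.isEquilibrium_iff hcz hv (N2_E0_ne_zero hs hp) hy.ne').2 ?_, ?_⟩
    · simp only [casimirZ, N2, Matrix.cons_val]
      linarith
    · rw [hrho]
      exact ⟨hq, hl⟩
    · rw [hpl.U_eq hcz hv, hrho]
      refine div_neg_of_neg_of_pos (sub_neg.2 hU) ?_
      have : c * z * V en (N2 sgn c en r z) ≠ 0 := by simp [hc.ne', hz.ne', hv]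
      exact sq_pos_iff.2 this

/-! ### Existence of parameters for every spin length. -/

theorem continuousOn_lapse (a b : ℝ) (ha : 0 < a) :
    ContinuousOn (fun r => √(lapse r)) (Set.Icc a b) := by
  have : ContinuousOn lapse (Set.Icc a b) := by
    unfold lapse
    exact continuousOn_const.sub (continuousOn_const.div continuousOn_id
      fun r hr => (ha.trans_le hr.1).ne')
  exact this.sqrt

theorem exists_last_zero {g : ℝ → ℝ} {a R : ℝ} (haR : a ≤ R) (hg : ContinuousOn g (Set.Icc a R))
    (ha : g a ≤ 0) (hR : 0 < g R) :
    ∃ s ∈ Set.Icc a R, s < R ∧ g s = 0 ∧ ∀ t ∈ Set.Ioc s R, 0 < g t := by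
  have hS : IsCompact (Set.Icc a R ∩ g ⁻¹' Set.Iic 0) :=
    isCompact_Icc.of_isClosed_subset (hg.preimage_isClosed_of_isClosed isClosed_Icc isClosed_Iic)
      Set.inter_subset_left
  obtain ⟨s, ⟨hs, hs0⟩, hmax⟩ := hS.exists_isGreatest ⟨a, ⟨le_rfl, haR⟩, ha⟩
  have hs0 : g s ≤ 0 := hs0
  have hsR : s < R := lt_of_le_of_ne hs.2 fun h => by rw [h] at hs0; linarith
  have hpos : ∀ t ∈ Set.Ioc s R, 0 < g t := by
    intro t ht
    by_contra! h
    exact absurd (hmax ⟨⟨hs.1.trans ht.1.le, ht.2⟩, h⟩) (not_le.2 ht.1)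
  refine ⟨s, hs, hsR, ?_, hpos⟩
  obtain ⟨t, ht, ht0⟩ := intermediate_value_Icc hs.2
    (hg.mono (Set.Icc_subset_Icc hs.1 le_rfl)) ⟨hs0, hR.le⟩
  rcases eq_or_lt_of_le ht.1 with h | h
  · rw [h, ht0]
  · exact absurd ht0 (hpos t ⟨h, ht.2⟩).ne'

/-- The cubic is linear in t, so t = N/D. Clearing denominators in the quadratic leaves F(r) = 0, to
be solved where D > N > 0, which is 0 < t < 1. -/
theorem exists_orbit_ratio {x : ℝ} (hx : 0 < x) : ∃ r t : ℝ, 2 < r ∧ 0 < t ∧ t < 1 ∧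
    3 * r * x ^ 2 * (1 - t ^ 2) + 3 * √(lapse r) * t * (2 * r ^ 3 + 4 * x ^ 2) * x
      = r * (r ^ 3 + 2 * (4 * x ^ 2)) * (1 - t ^ 2) ∧
    3 * √(lapse r) * x ^ 3 + 3 * √(lapse r) * r ^ 3 * x - 3 * x ^ 2 * t * r * (r - 1)
      + t * r ^ 2 * (4 * x ^ 2 - r ^ 2 * (r - 3)) = 0 := by
  set D : ℝ → ℝ := fun r => r * (3 * x ^ 2 * (r - 1) + r * (r ^ 3 - 3 * r ^ 2 - 4 * x ^ 2)) with hD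
  set N : ℝ → ℝ := fun r => 3 * √(lapse r) * x * (x ^ 2 + r ^ 3) with hN
  set F : ℝ → ℝ := fun r => (r * (r ^ 3 + 5 * x ^ 2)) * (D r ^ 2 - N r ^ 2)
    - 3 * √(lapse r) * x * (2 * r ^ 3 + 4 * x ^ 2) * N r * D r with hF
  -- This choice ensures R ≥ 10 and x ≤ R/10, enough for D ≥ 20N and F ≥ 0 at R.
  set R : ℝ := 10 + 10 * x with hR
  have hR10 : 10 ≤ R := by linarith
  have hb := continuousOn_lapse 3 R (by norm_num)
  have hDc : ContinuousOn D (Set.Icc 3 R) := by fun_prop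
  have hNc : ContinuousOn N (Set.Icc 3 R) := by fun_prop
  have hFc : ContinuousOn F (Set.Icc 3 R) := by fun_prop
  have hbpos : ∀ r, 3 ≤ r → 0 < √(lapse r) := fun r hr =>
    Real.sqrt_pos.2 (lapse_pos (by linarith))
  have hNpos : ∀ r, 3 ≤ r → 0 < N r := fun r hr => by
    have := hbpos r hr
    have : 0 < r := by linarith
    simp only [hN]; positivity
  have hR0 : 0 < R := by linarith
  have hb1 : √(lapse R) ≤ 1 := by
    have : 0 < 2 / R := by positivity
    exact Real.sqrt_le_iff.2 ⟨zero_le_one, by rw [lapse]; linarith⟩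
  have hbx : √(lapse R) * x ≤ R / 10 := by
    have := mul_le_mul_of_nonneg_right hb1 hx.le
    linarith
  have hx2 : 100 * x ^ 2 ≤ R ^ 2 := by
    have := pow_le_pow_left₀ hx.le (by linarith : x ≤ R / 10) 2
    linarith
  have hR3 : 10 * R ^ 2 ≤ R ^ 3 := by
    have := mul_le_mul_of_nonneg_right hR10 (sq_nonneg R)
    linarith
  have hDN : 20 * N R ≤ D R := by
    have h1 : √(lapse R) * x * (x ^ 2 + R ^ 3) ≤ R / 10 * (1001 / 1000 * R ^ 3) :=
      mul_le_mul hbx (by linarith) (by positivity) (by positivity)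
    have h2 : R * x ^ 2 * (4 * R) ≤ R * (R ^ 2 / 100) * (4 * R) := by gcongr; linarith
    have h3 : 0 ≤ 3 * R * x ^ 2 * (R - 1) := by
      have : 0 ≤ R - 1 := by linarith
      positivity
    have h4 := mul_le_mul_of_nonneg_right hR10 (by positivity : 0 ≤ R ^ 4)
    simp only [hN, hD]
    linarith
  have hFR : 0 ≤ F R := by
    have hNR := hNpos R (by linarith)
    have hDR : 0 < D R := by linarith
    have h1 : √(lapse R) * x * (2 * R ^ 3 + 4 * x ^ 2) * (20 * N R * D R)
        ≤ R / 10 * (3 * R ^ 3) * (D R * D R) := by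
      have : 0 < R ^ 3 := by positivity
      gcongr
      linarith
    have h2 : (20 * N R) ^ 2 ≤ D R ^ 2 := pow_le_pow_left₀ (by positivity) hDN 2
    have h3 : R ^ 4 * (D R ^ 2 - N R ^ 2) ≤ R * (R ^ 3 + 5 * x ^ 2) * (D R ^ 2 - N R ^ 2) := by
      have h4 : 0 ≤ D R ^ 2 - N R ^ 2 := by linarith [sq_nonneg (N R)]
      gcongr
      have : 0 ≤ R * (5 * x ^ 2) := by positivity
      linarith
    have h4 := mul_le_mul_of_nonneg_left h2 (by positivity : 0 ≤ R ^ 4)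
    have h5 : 0 ≤ R ^ 4 * D R ^ 2 := by positivity
    simp only [hF]
    clear_value D N F R
    linarith
  have hg3 : D 3 - N 3 ≤ 0 := by
    have := hNpos 3 le_rfl
    have : D 3 = -18 * x ^ 2 := by simp only [hD]; ring
    nlinarith [sq_nonneg x]
  obtain ⟨s, hs, hsR, hs0, hpos⟩ := exists_last_zero (g := fun r => D r - N r) (a := 3) (R := R)
    (by linarith) (hDc.sub hNc) hg3 (by linarith [hNpos R (by linarith)])
  -- At `s` the ratio N/D is 1, so the term with D² - N² vanishes and only the negative term of F is
  -- left. Beyond `s`, D stays above N.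
  have hFs : F s < 0 := by
    have h1 : D s = N s := by linarith
    have h2 := hNpos s hs.1
    have h3 := hbpos s hs.1
    have h4 : 0 < s := by linarith [hs.1]
    have h5 : 0 < 3 * √(lapse s) * x * (2 * s ^ 3 + 4 * x ^ 2) * N s * N s := by positivity
    simp only [hF, h1]
    linarith
  obtain ⟨r, hr, hr0⟩ := intermediate_value_Icc hsR.le
    (hFc.mono (Set.Icc_subset_Icc hs.1 le_rfl)) ⟨hFs.le, hFR⟩
  have hsr : s < r := lt_of_le_of_ne hr.1 fun h => by rw [h, hr0] at hFs; exact lt_irrefl _ hFs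
  have hr3 : 3 ≤ r := hs.1.trans hr.1
  have hNr := hNpos r hr3
  have hgr : 0 < D r - N r := hpos r ⟨hsr, hr.2⟩
  have hDr : 0 < D r := by linarith
  refine ⟨r, N r / D r, by linarith, div_pos hNr hDr, (div_lt_one hDr).2 (by linarith), ?_, ?_⟩
  · simp only [hF] at hr0
    field_simp
    linear_combination -hr0
  · have h1 : N r / D r * D r = N r := div_mul_cancel₀ _ hDr.ne'
    have h2 : N r = 3 * √(lapse r) * x * (x ^ 2 + r ^ 3) := rfl
    have h3 : D r = r * (3 * x ^ 2 * (r - 1) + r * (r ^ 3 - 3 * r ^ 2 - 4 * x ^ 2)) := rfl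
    generalize N r / D r = t at *
    rw [h2, h3] at h1
    linear_combination -h1

theorem exists_parameters {c : ℝ} (hc : 0 < c) :
    ∃ en r z : ℝ, ParameterRange c en r z ∧ ParameterSystem c en r z := by
  -- The value x = c/2 corresponds to w = z/2, which ensures W² < z². Then z comes from z²(1 - t²) =
  -- c², and the energy is the one for which W = z/2.
  obtain ⟨r, t, hr, ht, ht1, hq, hl⟩ := exists_orbit_ratio (half_pos hc)
  have ht2 : 0 < 1 - t ^ 2 := sub_pos.2 (pow_lt_one₀ ht.le ht1 two_ne_zero)
  have hs := Real.sqrt_pos.2 ht2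
  set z := c / √(1 - t ^ 2) with hz
  have hz0 : 0 < z := div_pos hc hs
  have hz2 : z ^ 2 * (1 - t ^ 2) = c ^ 2 := by
    rw [hz, div_pow, Real.sq_sqrt ht2.le]
    field_simp
  clear_value z
  have hy2 : z ^ 2 - c ^ 2 = (t * z) ^ 2 := by linear_combination hz2
  have hy : √(z ^ 2 - c ^ 2) = t * z := by rw [hy2, Real.sqrt_sq (by positivity)]
  have hcz : c < z := by
    refine lt_of_pow_lt_pow_left₀ 2 hz0.le ?_
    have : 0 < (t * z) ^ 2 := by positivity
    linarith
  have hb := Real.sqrt_pos.2 (lapse_pos hr)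
  have hr0 : 0 < r := by linarith
  set en := t * z / (2 * r ^ 2) + √(lapse r) * z / c with hen
  have hW : orbitW c en r z = z / 2 := by
    rw [orbitW, hy, hen]
    field_simp
    ring
  have hp : ParameterRange c en r z := by
    refine ⟨hr, hcz, ?_⟩
    rw [hW, div_pow]
    have : 0 < z ^ 2 := by positivity
    linarith
  refine ⟨en, r, z, hp, ?_⟩
  have hrb : r * √(lapse r) ^ 2 = r - 2 := by rw [sqrt_lapse_sq hr, mul_lapse hr0.ne']
  have hQ : orbitQuadratic c √(lapse r) r (t * z) z (z / 2) = 0 := by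
    refine mul_left_cancel₀ hc.ne' ?_
    rw [orbitQuadratic]
    linear_combination z ^ 4 * hq
      - z ^ 2 * (3 * r * c ^ 2 / 4 - r * (r ^ 3 + 2 * c ^ 2)) * hz2
  rw [parameterSystem_iff hc hp, hW, hy]
  refine ⟨by positivity, hQ, (orbitCubic_eq_zero_iff hc.ne' hr hb.ne' hz0.ne' hrb hQ).1 ?_⟩
  rw [orbitCubic]
  linear_combination z ^ 3 * hl

/-! ### States of the body, their momentum and spin vector. -/

theorem spinVector_one (en : ℝ) (s : BodyState) : s.spinVector en 1 =
    (-s.momentum en 0 * (s.spinLower 2 3 - s.spinLower 3 2)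
      + s.momentum en 2 * (s.spinLower 0 3 - s.spinLower 3 0)
      - s.momentum en 3 * (s.spinLower 0 2 - s.spinLower 2 0))
      / (2 * (s.r ^ 2 * Real.sin s.th)) := by
  rw [BodyState.spinVector]
  congr 1
  simp only [Fin.sum_univ_four, leviCivita, Fin.val_zero, Fin.val_one, Fin.val_two,
    show ((3 : Fin 4) : ℕ) = 3 from rfl]
  push_cast
  ring

theorem spinVector_two (en : ℝ) (s : BodyState) : s.spinVector en 2 =
    (s.momentum en 0 * (s.spinLower 1 3 - s.spinLower 3 1)
      - s.momentum en 1 * (s.spinLower 0 3 - s.spinLower 3 0)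
      + s.momentum en 3 * (s.spinLower 0 1 - s.spinLower 1 0))
      / (2 * (s.r ^ 2 * Real.sin s.th)) := by
  rw [BodyState.spinVector]
  congr 1
  simp only [Fin.sum_univ_four, leviCivita, Fin.val_zero, Fin.val_one, Fin.val_two,
    show ((3 : Fin 4) : ℕ) = 3 from rfl]
  push_cast
  ring

theorem spinVector_three (en : ℝ) (s : BodyState) : s.spinVector en 3 =
    (-s.momentum en 0 * (s.spinLower 1 2 - s.spinLower 2 1)
      + s.momentum en 1 * (s.spinLower 0 2 - s.spinLower 2 0)
      - s.momentum en 2 * (s.spinLower 0 1 - s.spinLower 1 0))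
      / (2 * (s.r ^ 2 * Real.sin s.th)) := by
  rw [BodyState.spinVector]
  congr 1
  simp only [Fin.sum_univ_four, leviCivita, Fin.val_zero, Fin.val_one, Fin.val_two,
    show ((3 : Fin 4) : ℕ) = 3 from rfl]
  push_cast
  ring

/-- The angular momentum conditions `Q₁ = Q₂ = 0` of a state. -/
theorem BodyState.pth_eq_zero {s : BodyState} (h1 : s.Q1 = 0) (h2 : s.Q2 = 0) : s.Pth = 0 := by
  rw [Q1] at h1
  rw [Q2] at h2
  linear_combination (-Real.sin s.ph) * h1 + Real.cos s.ph * h2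
    - s.Pth * Real.sin_sq_add_cos_sq s.ph

theorem BodyState.L0_eq {s : BodyState} (hs : Real.sin s.th ≠ 0) (h1 : s.Q1 = 0) (h2 : s.Q2 = 0) :
    s.L 0 = s.Pph * Real.cos s.th := by
  rw [Q1] at h1
  rw [Q2] at h2
  have : (s.L 0 - s.Pph * Real.cos s.th) / Real.sin s.th = 0 := by
    linear_combination Real.cos s.ph * h1 + Real.sin s.ph * h2
      - (s.L 0 - s.Pph * Real.cos s.th) / Real.sin s.th * Real.sin_sq_add_cos_sq s.ph
  rw [div_eq_zero_iff, or_iff_left hs] at this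
  linarith

/-- The shape of a state over a planar point. -/
structure BodyState.IsPlanarOver (s : BodyState) (sig : ℝ) (x : ReducedState) : Prop where
  sin_pos : 0 < Real.sin s.th
  sig_eq : sig = 1 ∨ sig = -1
  r_eq : s.r = x.r
  Pr_eq : s.Pr = 0
  Pth_eq : s.Pth = 0
  L0_eq : s.L 0 = x.E 0
  L0_eq' : s.L 0 = s.Pph * Real.cos s.th
  L1_eq : s.L 1 = sig * rho x
  L2_eq : s.L 2 = 0
  M0_eq : s.M 0 = -(x.Z 0 * rho x / x.Z 1)
  M1_eq : s.M 1 = sig * (x.E 0 * x.Z 0 / x.Z 1)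
  M2_eq : s.M 2 = 0
  E1_eq : s.Pph * Real.sin s.th = -(sig * x.E 1)

/-- With Q₁ = Q₂ = 0, the vanishing of E₃ and Z₃ forces the third components of L and M to vanish.
The reduction then fixes the rest of L and M up to the sign of L₂, with L · M = 0 supplying M₂. -/
theorem BodyState.IsOver.isPlanarOver {s : BodyState} {k en : ℝ} {x : ReducedState}
    (h : s.IsOver x) (hx : IsPlanarPoint k en x) (hE : x.E 0 ≠ 0) :
    ∃ sig, s.IsPlanarOver sig x := by
  obtain ⟨h0, hpi, hLM, hred, h1, h2⟩ := h
  have hsin := Real.sin_pos_of_pos_of_lt_pi h0 hpi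
  have hPth := pth_eq_zero h1 h2
  have hL0 := L0_eq hsin.ne' h1 h2
  have hE2 := hx.E2_eq
  have hZ2 := hx.Z2_eq
  have hPr := hx.Pr_eq
  have hz := hx.Z1_pos
  have hw := hx.rho_pos
  have hn : √(s.L 1 ^ 2 + s.L 2 ^ 2) = rho x := by
    subst hred
    rw [rho]
    simp only [reduce, Matrix.cons_val_zero, Matrix.cons_val_one]
    rw [Real.sq_sqrt (by positivity)]
    congr 1; ring
  have hP : s.Pph ≠ 0 := by
    intro h
    rw [h, zero_mul] at hL0
    subst hred
    exact hE hL0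
  have hA : s.L 0 * Real.cos s.th - s.Pph = -(s.Pph * Real.sin s.th ^ 2) := by
    rw [hL0, Real.sin_sq]; ring
  have hL2 : s.L 2 = 0 := by
    have : x.E 2 = s.L 2 * (s.L 0 * Real.cos s.th - s.Pph) / (Real.sin s.th * rho x) := by
      rw [← hn, ← hred]
      simp [reduce, hPth]
    rw [hE2, hA] at this
    simpa [hP, hsin.ne', hw.ne'] using this.symm
  have hn2 : s.L 1 ^ 2 = rho x ^ 2 := by
    rw [← hn, Real.sq_sqrt (by positivity), hL2]; ring
  obtain ⟨sig, hsig, hL1⟩ : ∃ sig : ℝ, (sig = 1 ∨ sig = -1) ∧ s.L 1 = sig * rho x := by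
    rcases sq_eq_sq_iff_eq_or_eq_neg.1 hn2 with h | h
    · exact ⟨1, Or.inl rfl, by rw [h, one_mul]⟩
    · exact ⟨-1, Or.inr rfl, by rw [h]; ring⟩
  have hsig2 : sig ^ 2 = 1 := by rcases hsig with h | h <;> norm_num [h]
  have hsig0 : sig ≠ 0 := by rcases hsig with h | h <;> norm_num [h]
  have hM2 : s.M 2 = 0 := by
    have : x.Z 2 = (s.M 1 * s.L 2 - s.M 2 * s.L 1) / rho x := by
      rw [← hn, ← hred]
      simp [reduce]
    rw [hZ2, hL2, hL1] at this
    simpa [hw.ne', hsig0] using this.symm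
  have hM0 : s.M 0 = -(x.Z 0 * rho x / x.Z 1) := by
    have e0 : x.Z 0 = -(s.M 0 * x.Z 1 / rho x) := by
      rw [← hn, ← hred]
      simp [reduce]
    rw [e0]
    field_simp
  have hE0 : s.L 0 = x.E 0 := by rw [← hred]; rfl
  refine ⟨sig, hsin, hsig, by rw [← hred]; rfl, by rw [← hPr, ← hred]; rfl, hPth, hE0,
    hL0, hL1, hL2, hM0, ?_, hM2, ?_⟩
  · rw [hM0, hL1, hL2, hE0] at hLM
    have h3 : rho x * (s.M 1 - sig * (x.E 0 * x.Z 0 / x.Z 1)) = 0 := by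
      linear_combination sig * hLM - rho x * s.M 1 * hsig2
    have := (mul_eq_zero.1 h3).resolve_left hw.ne'
    linarith
  · have e1 : x.E 1 = -(sig * (s.Pph * Real.sin s.th)) := by
      have : x.E 1 = s.L 1 * (s.L 0 * Real.cos s.th - s.Pph) / (Real.sin s.th * rho x) := by
        rw [← hn, ← hred]
        simp [reduce, hPth]
      rw [this, hA, hL1]
      field_simp
    rw [e1]
    linear_combination (-(s.Pph * Real.sin s.th)) * hsig2

namespace BodyState.IsPlanarOver

variable {s : BodyState} {sig k en : ℝ} {x : ReducedState} (h : s.IsPlanarOver sig x)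
  (hx : IsPlanarPoint k en x)

include h

theorem sig_sq : sig ^ 2 = 1 := by rcases h.sig_eq with h | h <;> norm_num [h]

theorem sig_ne : sig ≠ 0 := by rcases h.sig_eq with h | h <;> norm_num [h]

theorem momentum_one : s.momentum en 1 = 0 := h.Pr_eq

theorem momentum_two : s.momentum en 2 = 0 := by
  simp [momentum, spinTetrad, h.Pth_eq, h.L2_eq]

theorem spinVector_three_eq : s.spinVector en 3 = 0 := by
  rw [spinVector_three, h.momentum_one, h.momentum_two]
  simp [spinLower, spinTetrad, h.L2_eq]

include hx

theorem momentum_zero : s.momentum en 0 = -(√(lapse x.r) * x.Z 1 / k) := by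
  simp only [momentum, spinTetrad, Matrix.cons_val, Matrix.of_apply]
  rw [h.M0_eq, h.r_eq, hx.en_eq]
  have := hx.Z1_pos.ne'
  have : x.r ≠ 0 := by linarith [hx.two_lt]
  have := hx.k_ne
  field_simp
  ring

theorem momentum_three : s.momentum en 3 = -(sig * Real.sin s.th * x.r * x.Z 0 / k) := by
  simp only [momentum, spinTetrad, Matrix.cons_val, Matrix.of_apply]
  have h1 : s.Pph - Real.cos s.th * s.L 0 = s.Pph * Real.sin s.th * Real.sin s.th := by
    rw [h.L0_eq']
    linear_combination (-s.Pph) * Real.sin_sq_add_cos_sq s.th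
  rw [h.L1_eq, h.r_eq]
  rw [h.E1_eq, hx.E1_eq] at h1
  have := hx.k_ne
  linear_combination h1

theorem spinVector_one_eq : s.spinVector en 1 =
    √(lapse x.r) * x.E 0 * (x.Z 1 ^ 2 - x.Z 0 ^ 2) / (k * x.Z 1) := by
  have hz := hx.Z1_pos.ne'
  have hk := hx.k_ne
  have hb := hx.lapse_pos.ne'
  have hr : x.r ≠ 0 := by linarith [hx.two_lt]
  have hsin := h.sin_pos.ne'
  have hl := sqrt_lapse_sq hx.two_lt
  rw [spinVector_one, h.momentum_zero hx, h.momentum_two, h.momentum_three hx]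
  simp only [spinLower, metric, scale, spinTetrad, Matrix.cons_val, Matrix.of_apply, h.r_eq,
    h.M1_eq, h.L0_eq, h.L2_eq, h.M2_eq]
  rw [← hl, Real.sqrt_sq hx.lapse_pos.le]
  field_simp
  rw [h.sig_sq]
  ring

theorem spinVector_two_eq : s.spinVector en 2 =
    sig * rho x * (x.Z 1 ^ 2 - x.Z 0 ^ 2) / (k * x.r * x.Z 1) := by
  have hz := hx.Z1_pos.ne'
  have hk := hx.k_ne
  have hb := hx.lapse_pos.ne'
  have hr : x.r ≠ 0 := by linarith [hx.two_lt]
  have hsin := h.sin_pos.ne'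
  have hl := sqrt_lapse_sq hx.two_lt
  rw [spinVector_two, h.momentum_zero hx, h.momentum_one, h.momentum_three hx]
  simp only [spinLower, metric, scale, spinTetrad, Matrix.cons_val, Matrix.of_apply, h.r_eq,
    h.M0_eq, h.L1_eq, h.L2_eq, h.M2_eq]
  rw [← hl, Real.sqrt_sq hx.lapse_pos.le]
  field_simp
  ring

end BodyState.IsPlanarOver

theorem BodyState.exists_isOver {k en : ℝ} {x : ReducedState} (hx : IsPlanarPoint k en x)
    (hE : 0 < x.E 1) : ∃ s : BodyState, s.IsOver x := by
  have hz := hx.Z1_pos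
  have hw := hx.rho_pos
  have hP2 : 0 < x.E 0 ^ 2 + x.E 1 ^ 2 := by positivity
  have hP := Real.sqrt_pos.2 hP2
  set P := √(x.E 0 ^ 2 + x.E 1 ^ 2) with hPdef
  have hPP : P ^ 2 = x.E 0 ^ 2 + x.E 1 ^ 2 := Real.sq_sqrt hP2.le
  have hlt : x.E 0 ^ 2 < P ^ 2 := by rw [hPP]; linarith [pow_pos hE 2]
  have habs := abs_lt_of_sq_lt_sq hlt hP.le
  have hu1 : -1 < x.E 0 / -P := by
    rw [div_neg, neg_lt_neg_iff, div_lt_one hP]; linarith [(abs_lt.1 habs).2]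
  have hu2 : x.E 0 / -P < 1 := by
    rw [div_neg, neg_lt, lt_div_iff₀ hP]; linarith [(abs_lt.1 habs).1]
  set th := Real.arccos (x.E 0 / -P) with hth
  have hcos : Real.cos th = x.E 0 / -P := Real.cos_arccos hu1.le hu2.le
  have hsin : Real.sin th = x.E 1 / P := by
    rw [hth, Real.sin_arccos, Real.sqrt_eq_iff_mul_self_eq_of_pos (by positivity)]
    field_simp
    linarith
  have hth0 : 0 < th := Real.arccos_pos.2 hu2
  have hthpi : th < Real.pi := by
    refine lt_of_le_of_ne (Real.arccos_le_pi _) fun h => ?_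
    rw [Real.arccos_eq_pi] at h
    linarith
  have hn : √(rho x ^ 2) = rho x := Real.sqrt_sq hw.le
  have hn2 : √(x.E 0 ^ 2 + rho x ^ 2) = x.Z 1 := by
    rw [hx.E0_sq, sub_add_cancel, Real.sqrt_sq hz.le]
  have hE0c : x.E 0 * (x.E 0 / -P) + P = x.E 1 ^ 2 / P := by
    field_simp
    linarith
  -- The sign of L₂ is taken positive. Then P_φ must be negative, since E₂ > 0 and sin θ > 0; the
  -- angle φ is free and set to zero.
  refine ⟨⟨![x.E 0, rho x, 0], ![-(x.Z 0 * rho x / x.Z 1), x.E 0 * x.Z 0 / x.Z 1, 0], x.r, th, 0,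
    0, 0, -P⟩, hth0, hthpi, ?_, ?_, ?_, ?_⟩
  · simp only [Matrix.cons_val]
    field_simp
    ring
  · have hext : ∀ a b : ReducedState, a.E = b.E → a.Z = b.Z → a.r = b.r → a.Pr = b.Pr → a = b := by
      rintro ⟨⟩ ⟨⟩ rfl rfl rfl rfl; rfl
    refine hext _ _ ?_ ?_ rfl hx.Pr_eq.symm
    · funext i
      fin_cases i
      · rfl
      · simp only [reduce, Matrix.cons_val, hcos, hsin, sub_neg_eq_add, hE0c, Fin.mk_one,
          ne_eq, OfNat.ofNat_ne_zero, not_false_eq_true, zero_pow, add_zero, hn]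
        field_simp
        simp
      · simp [reduce, hx.E2_eq]
    · funext i
      fin_cases i
      · simp only [reduce, Matrix.cons_val, Fin.zero_eta,
          ne_eq, OfNat.ofNat_ne_zero, not_false_eq_true, zero_pow, add_zero, hn, hn2]
        field_simp
      · simp [reduce, hn2]
      · simp [reduce, hx.Z2_eq]
  · simp [Q1, hcos]
    field_simp
    simp
  · simp [Q2]

/-- The spin vector at a state over an asymmetric orbit. -/
theorem BodyState.IsPlanarOver.spin {s : BodyState} {sig k en : ℝ} {x : ReducedState}
    (h : s.IsPlanarOver sig x) (hx : IsPlanarPoint k en x) (hE : x.E 0 ≠ 0) (hZ : x.Z 0 ≠ 0)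
    (hk : k ^ 2 = x.Z 1 ^ 2 - x.Z 0 ^ 2) :
    s.spinVector en 1 ≠ 0 ∧ s.spinVector en 2 ≠ 0 ∧ s.spinVector en 3 = 0 ∧
      LinearIndependent ℝ ![s.spinTriad en, s.orbitalTriad en] := by
  have hz := hx.Z1_pos.ne'
  have hk0 := hx.k_ne
  have hb := hx.lapse_pos.ne'
  have hr : x.r ≠ 0 := by linarith [hx.two_lt]
  have hsin := h.sin_pos.ne'
  have hw := hx.rho_pos.ne'
  have hsig := h.sig_ne
  have h1 : s.spinVector en 1 ≠ 0 := by
    rw [h.spinVector_one_eq hx, ← hk]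
    positivity
  have h2 : s.spinVector en 2 ≠ 0 := by
    rw [h.spinVector_two_eq hx, ← hk]
    positivity
  have h3 : s.momentum en 3 ≠ 0 := by
    rw [h.momentum_three hx]
    simp [hsig, hsin, hr, hZ, hk0]
  refine ⟨h1, h2, h.spinVector_three_eq, ?_⟩
  rw [LinearIndependent.pair_iff]
  -- The orbital vector has no e₁ component, so the e₁ component of the relation kills the
  -- coefficient of the spin; the e₂ component, with p_φ ≠ 0, kills the other.
  intro a b hab
  have e0 := congrFun hab 0
  have e1 := congrFun hab 1
  simp only [spinTriad, orbitalTriad, cross_apply, Matrix.cons_val, Pi.add_apply, Pi.smul_apply,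
    smul_eq_mul, Pi.zero_apply, zero_mul, sub_self, mul_zero, add_zero, zero_sub, h.r_eq] at e0 e1
  have ha : a = 0 := by simpa [h1, hb] using e0
  refine ⟨ha, ?_⟩
  simpa [ha, h3, hr, hsin] using e1

end SpinningBody

theorem mainTheorem4 (c : ℝ) (hc : 0 < c) :
    (∀ sgn en r z : ℝ, (sgn = 1 ∨ sgn = -1) → ParameterRange c en r z →
      (IsRelativeEquilibrium c en (N2 sgn c en r z) ↔ ParameterSystem c en r z)) ∧
    (∀ sgn en r z : ℝ, (sgn = 1 ∨ sgn = -1) → ParameterRange c en r z →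
      ParameterSystem c en r z →
      (N2 sgn c en r z).E 2 = 0 ∧ (N2 sgn c en r z).E 0 ≠ 0 ∧
      (∃ s : BodyState, s.IsOver (N2 sgn c en r z)) ∧
      (∀ s : BodyState, s.IsOver (N2 sgn c en r z) →
        s.Pth = 0 ∧ s.Pph ≠ 0 ∧ Real.cos s.th = (N2 sgn c en r z).E 0 / s.Pph ∧
        s.th ≠ Real.pi / 2 ∧
        s.spinVector en 1 ≠ 0 ∧ s.spinVector en 2 ≠ 0 ∧ s.spinVector en 3 = 0 ∧
        LinearIndependent ℝ ![s.spinTriad en, s.orbitalTriad en])) ∧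
    (∃ en r z : ℝ, ParameterRange c en r z ∧ ParameterSystem c en r z) := by
  refine ⟨fun sgn en r z hs hp => isRelativeEquilibrium_N2_iff hs hc hp, ?_,
    exists_parameters hc⟩
  intro sgn en r z hs hp hsys
  have hw := ((parameterSystem_iff hc hp).1 hsys).1
  have hx := isPlanarPoint_N2 hs hc hp hw
  have hE0 := N2_E0_ne_zero hs hp
  have hy := hp.sqrt_pos hc
  have hb := hp.lapse_pos
  have hr : 0 < r := by linarith [hp.1]
  -- W > 0 makes both summands of E₂ positive, as the construction of a state requires.
  have hE1 : 0 < (N2 sgn c en r z).E 1 := by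
    change 0 < orbitE2 c en r z
    rw [hp.orbitE2_eq hc]
    positivity
  refine ⟨rfl, hE0, BodyState.exists_isOver hx hE1, fun s hs => ?_⟩
  obtain ⟨sig, h⟩ := hs.isPlanarOver hx hE0
  have hL := h.L0_eq'
  rw [h.L0_eq] at hL
  have hP : s.Pph ≠ 0 := by
    intro h0
    rw [h0, zero_mul] at hL
    exact hE0 hL
  refine ⟨h.Pth_eq, hP, by rw [hL]; field_simp, fun hth => ?_,
    h.spin hx hE0 hy.ne' (hp.sq_eq hc)⟩
  rw [hth, Real.cos_pi_div_two, mul_zero] at hL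
  exact hE0 hL
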